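/- Let $n\ge 2$. For $f\in L^p(\mathbb R^n)$, $1\le p\le 2$ (complex-valued), let $\widehat f$ be its Fourier transform, $\widehat f(\xi)=\int_{\mathbb R^n} f(x)e^{-i x\cdot\xi}\,dx$ for $f\in L^1(\mathbb R^n)$, extended as usual to $L^1(\mathbb R^n)+L^2(\mathbb R^n)\supset L^p(\mathbb R^n)$, and for $t>0$ let $$M^tf(x)=\frac1{\omega_{n-1}}\int_{S^{n-1}}f(x+t\omega)\,d\omega$$ be its spherical mean, where $d\omega$ is the surface measure of the unit sphere $S^{n-1}$ and $\omega_{n-1}$ its total mass. (1) Let $1<p<2$ and $\frac1p+\frac1q=1$. There is a constant $C=C(p,n)$ such that for all $f\in L^p(\mathbb R^n)$ and all $t>0$ $$\left(\int_{\mathbb R^n}\min\{1,(t|\xi|)^{2q}\}\,|\widehat f(\xi)|^q\,d\xi\right)^{1/q}\le C\,\|M^tf-f\|_p .$$ (2) There is a constant $C=C(n)$ such that for all $f\in L^1(\mathbb R^n)$ and all $t>0$ $$\sup_{\xi\in\mathbb R^n}\Big[\min\{1,(t|\xi|)^2\}\,|\widehat f(\xi)|\Big]\le C\,\|M^tf-f\|_1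 .$$ (3) There are constants $c,C>0$ depending only on $n$ such that for all $f\in L^2(\mathbb R^n)$ and all $t>0$ $$c\,\|M^tf-f\|_2\le\left(\int_{\mathbb R^n}\min\{1,(t|\xi|)^4\}\,|\widehat f(\xi)|^2\,d\xi\right)^{1/2}\le C\,\|M^tf-f\|_2 .$$ -/

import Mathlib

open MeasureTheory
open scoped ENNReal NNReal FourierTransform

noncomputable section

namespace SphericalGrowth

/-- The spherical mean `M^t f (x) = (1 / ω_{n-1}) ∫_{S^{n-1}} f (x + t ω) dω`, where `dω` is the
surface measure of the unit sphere of `ℝⁿ` and `ω_{n-1}` its total mass. -/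
def sphericalMean {n : ℕ} (t : ℝ) (f : EuclideanSpace ℝ (Fin n) → ℂ) :
    EuclideanSpace ℝ (Fin n) → ℂ := fun x =>
  ⨍ ω : Metric.sphere (0 : EuclideanSpace ℝ (Fin n)) 1,
    f (x + t • (ω : EuclideanSpace ℝ (Fin n)))
    ∂(volume : Measure (EuclideanSpace ℝ (Fin n))).toSphere

/-- The Fourier transform `f̂ (ξ) = ∫ f (x) e^{-i x·ξ} dx` of an integrable function. -/
def fourierL1 {n : ℕ} (f : EuclideanSpace ℝ (Fin n) → ℂ) :
    EuclideanSpace ℝ (Fin n) → ℂ := fun ξ =>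
  ∫ x, Complex.exp (-Complex.I * ((inner ℝ x ξ : ℝ) : ℂ)) * f x

/-- The normalization of `fourierL1` is Mathlib's up to the dilation `ξ ↦ ξ / (2π)`. -/
theorem fourierL1_eq {n : ℕ} (f : EuclideanSpace ℝ (Fin n) → ℂ)
    (ξ : EuclideanSpace ℝ (Fin n)) :
    fourierL1 f ξ = 𝓕 f ((2 * Real.pi)⁻¹ • ξ) := by
  rw [fourierL1, Real.fourier_eq']
  refine integral_congr_ae (Filter.Eventually.of_forall fun x => ?_)
  simp only [smul_eq_mul, inner_smul_right]
  congr 2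
  have h : (Real.pi : ℂ) ≠ 0 := by exact_mod_cast Real.pi_ne_zero
  push_cast
  field_simp

/-- The Fourier transform of a square-integrable function in the normalization of `fourierL1`,
that is, (a representative of) the image under the continuous extension to `L²` of the Fourier
transform of Schwartz functions. The value is `0` if `f` is not square-integrable. -/
def fourierL2 {n : ℕ} (f : EuclideanSpace ℝ (Fin n) → ℂ) :
    EuclideanSpace ℝ (Fin n) → ℂ := fun ξ =>
  open scoped Classical in
  if h : MemLp f 2 (volume : Measure (EuclideanSpace ℝ (Fin n))) then
    (𝓕 (h.toLp f) : Lp ℂ 2 (volume : Measure (EuclideanSpace ℝ (Fin n)))) ((2 * Real.pi)⁻¹ • ξ)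
  else 0

/-- The Fourier transform on `L^p(ℝⁿ)`, `1 ≤ p ≤ 2` (determined almost everywhere), through the
inclusion of `L^p` in `L¹ + L²`: where `|f| > 1` the function is integrable, where `|f| ≤ 1` it
is square-integrable. -/
def fourierLp {n : ℕ} (f : EuclideanSpace ℝ (Fin n) → ℂ) :
    EuclideanSpace ℝ (Fin n) → ℂ := fun ξ =>
  fourierL1 ({x | 1 < ‖f x‖}.indicator f) ξ + fourierL2 ({x | ‖f x‖ ≤ 1}.indicator f) ξ

end SphericalGrowth

end

/-!
On the Fourier side the spherical mean `M^t` is multiplication by `m (t ξ)`, where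
`m = sphereMultiplier` is the Fourier transform of the normalized surface measure, a real function.
Everything rests on the two-sided bound `c * min 1 (‖ξ‖ ^ 2) ≤ 1 - m ξ ≤ 2 * min 1 (‖ξ‖ ^ 2)`
(`le_one_sub_sphereMultiplier`, `one_sub_sphereMultiplier_le`); the three parts of the theorem then
follow from the boundedness of the Fourier transform `L^p → L^q`, `L¹ → L^∞` and `L² → L²`, applied
to `M^t f - f`.

The upper bound is the one for `1 - cos`. For the lower one, `1 - m ξ` is the average of
`1 - cos ⟪ω, ξ⟫` over the sphere and, by rotation invariance, depends on `‖ξ‖` only. Hence `ξ` may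
be averaged over a circle in a coordinate plane, which is available because `n ≥ 2`; after an
exchange of integrals it suffices to bound `1 - J₀(s)` below by a multiple of `min 1 (s ^ 2)`. On a
quarter of the circle `cos θ ≤ 1` may be inserted in the integral defining `1 - J₀(s)`, which turns
it into `1 - sin s / s` (`le_integral_one_sub_cos_mul_sin`).

The multiplier identity is Fubini's theorem on `L¹`. It extends to `L²` by density, since the
transforms on `L¹` and `L²` agree on the intersection (`fourierL2_ae_eq_fourierL1`), and then to
`L^p` by splitting `f`; the transform on `L^p` does not depend on the splitting (`fourierLp_ae_eq`).

The Hausdorff–Young inequality is obtained up to a constant by real interpolation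
(`exists_hausdorffYoung`): at each height `α` the function `f` is cut at a level for which the
transform of the large part is bounded by `α / 2`, Chebyshev's inequality and Plancherel's theorem
control the small part, and the resulting bound is integrated in `α`.
-/

namespace SphericalGrowth

/-! ### A lower bound for averages of `1 - cos` over a circle -/

theorem mul_min_le_sub_sin {s : ℝ} (hs : 0 ≤ s) :
    s * (1 / 50 * min 1 (s ^ 2)) ≤ s - Real.sin s := by
  have small : ∀ x : ℝ, 0 ≤ x → x ≤ 1 → x ^ 3 * (11 / 96) ≤ x - Real.sin x := by
    intro x hx hx1
    have h := (abs_le.1 (Real.sin_bound (abs_le.2 ⟨by linarith, hx1⟩))).2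
    rw [abs_of_nonneg hx] at h
    have : x ^ 5 ≤ x ^ 3 := pow_le_pow_of_le_one hx hx1 (by norm_num)
    have h3 : 0 ≤ x ^ 3 := by positivity
    linarith
  rcases le_total s 1 with h1 | h1
  · have h3 : 0 ≤ s ^ 3 := by positivity
    have := mul_le_mul_of_nonneg_left (min_le_right 1 (s ^ 2)) hs
    have := small s hs h1
    nlinarith
  have hm : s * (1 / 50 * min 1 (s ^ 2)) ≤ s / 50 := by
    have := mul_le_mul_of_nonneg_left (min_le_left 1 (s ^ 2)) hs
    linarith
  rcases le_total s 2 with h2 | h2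
  · -- `sin s ≤ 2 sin (s / 2)` reduces to the range where the Taylor bound applies
    have h := small (s / 2) (by linarith) (by linarith)
    have hsin : Real.sin s ≤ 2 * Real.sin (s / 2) := by
      have hd : Real.sin s = 2 * Real.sin (s / 2) * Real.cos (s / 2) := by
        rw [← Real.sin_two_mul]; congr 1; ring
      have h0 : 0 ≤ Real.sin (s / 2) :=
        Real.sin_nonneg_of_nonneg_of_le_pi (by linarith) (by linarith [Real.pi_gt_three])
      rw [hd]
      nlinarith [Real.cos_le_one (s / 2)]
    have h3 : s ≤ s ^ 3 := le_self_pow₀ h1 (by norm_num)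
    nlinarith
  · linarith [Real.sin_le_one s]

/-- The mean of `1 - cos (s sin θ)` over the circle is `1 - J₀(s)`. On a quarter of the circle the
weight `cos θ ≤ 1` may be inserted, after which the integrand has an elementary primitive. -/
theorem le_integral_one_sub_cos_mul_sin {s : ℝ} (hs : 0 ≤ s) :
    1 / 50 * min 1 (s ^ 2) ≤ ∫ θ in (0 : ℝ)..(2 * Real.pi), (1 - Real.cos (s * Real.sin θ)) := by
  have hpi := Real.pi_pos
  have nonneg : ∀ θ : ℝ, 0 ≤ 1 - Real.cos (s * Real.sin θ) := fun θ => by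
    linarith [Real.cos_le_one (s * Real.sin θ)]
  rcases hs.eq_or_lt with rfl | hs0
  · simp
  have quarter : ∫ θ in (0 : ℝ)..(Real.pi / 2), (1 - Real.cos (s * Real.sin θ)) * Real.cos θ =
      1 - Real.sin s / s := by
    rw [intervalIntegral.integral_eq_sub_of_hasDerivAt
      (f := fun θ => Real.sin θ - Real.sin (s * Real.sin θ) / s)]
    · simp
    · intro θ _
      have h := (Real.hasDerivAt_sin θ).sub
        ((((Real.hasDerivAt_sin θ).const_mul s).sin).div_const s)
      refine h.congr_deriv ?_
      field_simp
    · exact Continuous.intervalIntegrable (by fun_prop) _ _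
  have hii : ∀ a b : ℝ, IntervalIntegrable (fun θ => 1 - Real.cos (s * Real.sin θ)) volume a b :=
    fun a b => Continuous.intervalIntegrable (by fun_prop) _ _
  calc 1 / 50 * min 1 (s ^ 2) ≤ (s - Real.sin s) / s := by
        rw [le_div_iff₀ hs0, mul_comm]; exact mul_min_le_sub_sin hs
    _ = ∫ θ in (0 : ℝ)..(Real.pi / 2), (1 - Real.cos (s * Real.sin θ)) * Real.cos θ := by
        rw [quarter]; field_simp
    _ ≤ ∫ θ in (0 : ℝ)..(Real.pi / 2), (1 - Real.cos (s * Real.sin θ)) := by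
        refine intervalIntegral.integral_mono_on (by positivity)
          (Continuous.intervalIntegrable (by fun_prop) _ _) (hii _ _) fun θ _ => ?_
        exact mul_le_of_le_one_right (nonneg θ) (Real.cos_le_one θ)
    _ ≤ ∫ θ in (0 : ℝ)..(2 * Real.pi), (1 - Real.cos (s * Real.sin θ)) := by
        refine intervalIntegral.integral_mono_interval le_rfl (by positivity) (by linarith)
          (Filter.Eventually.of_forall nonneg) (hii _ _)

theorem le_integral_one_sub_cos_circle (a b : ℝ) :
    1 / 50 * min 1 (a ^ 2 + b ^ 2) ≤
      ∫ θ in (0 : ℝ)..(2 * Real.pi), (1 - Real.cos (a * Real.cos θ + b * Real.sin θ)) := by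
  set z : ℂ := ⟨b, a⟩ with hz
  have hb : b = ‖z‖ * Real.cos z.arg := (Complex.norm_mul_cos_arg z).symm
  have ha : a = ‖z‖ * Real.sin z.arg := (Complex.norm_mul_sin_arg z).symm
  have hn : a ^ 2 + b ^ 2 = ‖z‖ ^ 2 := by
    rw [← Complex.normSq_eq_norm_sq, Complex.normSq_apply]; simp only [hz]; ring
  have hper : Function.Periodic (fun θ => 1 - Real.cos (‖z‖ * Real.sin θ)) (2 * Real.pi) := by
    intro θ; simp
  have hshift := hper.intervalIntegral_add_eq z.arg 0
  rw [hn]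
  refine (le_integral_one_sub_cos_mul_sin (norm_nonneg z)).trans_eq ?_
  rw [zero_add] at hshift
  have hmove := intervalIntegral.integral_comp_add_right (a := 0) (b := 2 * Real.pi)
    (fun θ => 1 - Real.cos (‖z‖ * Real.sin θ)) z.arg
  rw [zero_add, add_comm (2 * Real.pi)] at hmove
  rw [← hshift, ← hmove]
  refine intervalIntegral.integral_congr fun θ _ => ?_
  have : a * Real.cos θ + b * Real.sin θ = ‖z‖ * Real.sin (θ + z.arg) := by
    rw [Real.sin_add]
    nth_rewrite 1 [ha, hb]
    ring
  simp only [this]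

/-! ### The normalized surface measure and its Fourier transform -/

/-- The surface measure of the unit sphere of `ℝⁿ`, normalized to total mass one. -/
noncomputable def sphereProb (n : ℕ) :
    Measure (Metric.sphere (0 : EuclideanSpace ℝ (Fin n)) 1) :=
  ((volume : Measure (EuclideanSpace ℝ (Fin n))).toSphere Set.univ)⁻¹ •
    (volume : Measure (EuclideanSpace ℝ (Fin n))).toSphere

theorem sphericalMean_eq {n : ℕ} (t : ℝ) (f : EuclideanSpace ℝ (Fin n) → ℂ)
    (x : EuclideanSpace ℝ (Fin n)) :
    sphericalMean t f x =
      ∫ ω, f (x + t • (ω : EuclideanSpace ℝ (Fin n))) ∂(sphereProb n) := rfl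

theorem isProbabilityMeasure_sphereProb {n : ℕ} (hn : 1 ≤ n) :
    IsProbabilityMeasure (sphereProb n) := by
  have : Nonempty (Fin n) := ⟨⟨0, hn⟩⟩
  have : NeZero (volume : Measure (EuclideanSpace ℝ (Fin n))).toSphere :=
    ⟨Measure.toSphere_ne_zero _⟩
  exact isProbabilityMeasureSMul

open scoped Pointwise in
theorem toSphere_rotation_apply {n : ℕ}
    (L : EuclideanSpace ℝ (Fin n) ≃ₗᵢ[ℝ] EuclideanSpace ℝ (Fin n))
    (g : Metric.sphere (0 : EuclideanSpace ℝ (Fin n)) 1 →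
      Metric.sphere (0 : EuclideanSpace ℝ (Fin n)) 1)
    (hg : ∀ ω, (g ω : EuclideanSpace ℝ (Fin n)) = L ω)
    {s : Set (Metric.sphere (0 : EuclideanSpace ℝ (Fin n)) 1)} (hs : MeasurableSet s)
    (hgs : MeasurableSet (g ⁻¹' s)) :
    (volume : Measure (EuclideanSpace ℝ (Fin n))).toSphere (g ⁻¹' s) =
      (volume : Measure (EuclideanSpace ℝ (Fin n))).toSphere s := by
  rw [Measure.toSphere_apply' _ hs, Measure.toSphere_apply' _ hgs]
  congr 1
  refine Eq.trans ?_ (L.measurePreserving.measure_preimage_equiv (f := L.toMeasurableEquiv)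
    (Set.Ioo (0 : ℝ) 1 • (Subtype.val '' s)))
  congr 1
  ext x
  simp only [Set.mem_preimage, Set.mem_smul, Set.mem_image]
  constructor
  · rintro ⟨r, hr, _, ⟨ω, hω, rfl⟩, rfl⟩
    exact ⟨r, hr, _, ⟨g ω, hω, rfl⟩, by simp [hg]⟩
  · rintro ⟨r, hr, _, ⟨ω, hω, rfl⟩, hx⟩
    have hx' : r • (ω : EuclideanSpace ℝ (Fin n)) = L x := hx
    have hmem : L.symm ω ∈ Metric.sphere (0 : EuclideanSpace ℝ (Fin n)) 1 := by simp
    refine ⟨r, hr, _, ⟨⟨L.symm ω, hmem⟩, ?_, rfl⟩, ?_⟩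
    · have : g ⟨L.symm ω, hmem⟩ = ω := Subtype.ext (by simp [hg])
      rwa [this]
    · apply L.injective
      simp [← hx']

theorem integral_sphere_rotation {n : ℕ} {F : Type*} [NormedAddCommGroup F] [NormedSpace ℝ F]
    (L : EuclideanSpace ℝ (Fin n) ≃ₗᵢ[ℝ] EuclideanSpace ℝ (Fin n))
    (h : EuclideanSpace ℝ (Fin n) → F) (hh : Continuous h) :
    ∫ ω, h (L (ω : EuclideanSpace ℝ (Fin n))) ∂(sphereProb n) =
      ∫ ω, h (ω : EuclideanSpace ℝ (Fin n)) ∂(sphereProb n) := by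
  let g : Metric.sphere (0 : EuclideanSpace ℝ (Fin n)) 1 →
      Metric.sphere (0 : EuclideanSpace ℝ (Fin n)) 1 := fun ω => ⟨L ω, by simp⟩
  have hg : Continuous g := by fun_prop
  have hmap : Measure.map g (sphereProb n) = sphereProb n := by
    ext s hs
    rw [Measure.map_apply hg.measurable hs, sphereProb, Measure.smul_apply, Measure.smul_apply,
      toSphere_rotation_apply L g (fun _ => rfl) hs (hg.measurable hs)]
  conv_rhs => rw [← hmap]
  rw [integral_map hg.measurable.aemeasurable]
  have : Continuous fun ω : Metric.sphere (0 : EuclideanSpace ℝ (Fin n)) 1 =>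
    h (ω : EuclideanSpace ℝ (Fin n)) := by fun_prop
  exact this.aestronglyMeasurable

/-- Reflections act transitively on spheres, so integrals over the sphere of a function of
`⟪ω, ξ⟫` depend on `‖ξ‖` only. -/
theorem integral_sphere_inner_congr {n : ℕ} {F : Type*} [NormedAddCommGroup F] [NormedSpace ℝ F]
    (h : ℝ → F) (hh : Continuous h) {ξ η : EuclideanSpace ℝ (Fin n)} (hξ : ‖ξ‖ = ‖η‖) :
    ∫ ω, h (inner ℝ (ω : EuclideanSpace ℝ (Fin n)) ξ) ∂(sphereProb n) =
      ∫ ω, h (inner ℝ (ω : EuclideanSpace ℝ (Fin n)) η) ∂(sphereProb n) := by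
  set L := (ℝ ∙ (ξ - η))ᗮ.reflection
  have hL : L ξ = η := Submodule.reflection_sub hξ
  rw [← integral_sphere_rotation L (fun ω => h (inner ℝ ω η)) (by fun_prop), ← hL]
  simp

theorem integrable_sphere {n : ℕ} (hn : 1 ≤ n) {F : Type*} [NormedAddCommGroup F]
    {h : EuclideanSpace ℝ (Fin n) → F} (hh : Continuous h) :
    Integrable (fun ω : Metric.sphere (0 : EuclideanSpace ℝ (Fin n)) 1 =>
      h (ω : EuclideanSpace ℝ (Fin n))) (sphereProb n) := by
  have := isProbabilityMeasure_sphereProb hn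
  have hc : Continuous fun ω : Metric.sphere (0 : EuclideanSpace ℝ (Fin n)) 1 =>
    h (ω : EuclideanSpace ℝ (Fin n)) := by fun_prop
  have : CompactSpace (Metric.sphere (0 : EuclideanSpace ℝ (Fin n)) 1) :=
    isCompact_iff_compactSpace.1 (isCompact_sphere _ _)
  exact hc.integrable_of_hasCompactSupport (HasCompactSupport.of_compactSpace _)

/-- The coordinates have equal second moments by rotation invariance, and these add up to one. -/
theorem integral_sphere_coord_sq {n : ℕ} (hn : 1 ≤ n) (i : Fin n) :
    ∫ ω, (ω : EuclideanSpace ℝ (Fin n)) i ^ 2 ∂(sphereProb n) = 1 / n := by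
  have := isProbabilityMeasure_sphereProb hn
  have hcoord : ∀ (ω : EuclideanSpace ℝ (Fin n)) (j : Fin n),
      inner ℝ ω (EuclideanSpace.single j (1 : ℝ)) = ω j := fun ω j => by
    simp [EuclideanSpace.inner_single_right]
  have hsame : ∀ j, ∫ ω, (ω : EuclideanSpace ℝ (Fin n)) j ^ 2 ∂(sphereProb n) =
      ∫ ω, (ω : EuclideanSpace ℝ (Fin n)) i ^ 2 ∂(sphereProb n) := fun j => by
    have := integral_sphere_inner_congr (n := n) (fun x : ℝ => x ^ 2) (by fun_prop)
      (ξ := EuclideanSpace.single j (1 : ℝ)) (η := EuclideanSpace.single i (1 : ℝ)) (by simp)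
    simpa only [hcoord] using this
  have hsum : ∑ j, ∫ ω, (ω : EuclideanSpace ℝ (Fin n)) j ^ 2 ∂(sphereProb n) = 1 := by
    rw [← integral_finsetSum _ fun j _ =>
      integrable_sphere (h := fun ω : EuclideanSpace ℝ (Fin n) => ω j ^ 2) hn (by fun_prop)]
    have : ∀ ω : Metric.sphere (0 : EuclideanSpace ℝ (Fin n)) 1,
        ∑ j, (ω : EuclideanSpace ℝ (Fin n)) j ^ 2 = 1 := fun ω => by
      rw [← EuclideanSpace.real_norm_sq_eq]; simp
    simp [this]
  have hn0 : (n : ℝ) ≠ 0 := by positivity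
  rw [Finset.sum_congr rfl fun j _ => hsame j] at hsum
  simp only [Finset.sum_const, Finset.card_univ, Fintype.card_fin, nsmul_eq_mul] at hsum
  field_simp
  linarith

/-- Averaging the sphere integral over the circle of directions in a coordinate plane reduces the
lower bound to the one over a circle. Two coordinates are needed: for `n = 1` the right side would be
`1 - cos ‖ξ‖`, which vanishes for arbitrarily large `ξ`. -/
theorem le_integral_one_sub_cos_sphere {n : ℕ} (hn : 2 ≤ n) (ξ : EuclideanSpace ℝ (Fin n)) :
    1 / (100 * Real.pi * n) * min 1 (‖ξ‖ ^ 2) ≤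
      ∫ ω, (1 - Real.cos (inner ℝ (ω : EuclideanSpace ℝ (Fin n)) ξ)) ∂(sphereProb n) := by
  have hn1 : 1 ≤ n := by lia
  have := isProbabilityMeasure_sphereProb hn1
  let i : Fin n := ⟨0, by lia⟩
  let j : Fin n := ⟨1, by lia⟩
  have hij : i ≠ j := by simp [i, j]
  set r := ‖ξ‖ with hr
  let v : ℝ → EuclideanSpace ℝ (Fin n) := fun θ =>
    EuclideanSpace.single i (r * Real.cos θ) + EuclideanSpace.single j (r * Real.sin θ)
  have hv : ∀ θ, ‖v θ‖ = ‖ξ‖ := fun θ => by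
    rw [← sq_eq_sq₀ (norm_nonneg _) (norm_nonneg _), ← real_inner_self_eq_norm_sq, ← hr]
    simp only [v, inner_add_left, inner_add_right, EuclideanSpace.inner_single_left,
      PiLp.single_apply]
    simp only [hij, hij.symm]
    simp
    linear_combination r ^ 2 * Real.sin_sq_add_cos_sq θ
  have hinner : ∀ (ω : EuclideanSpace ℝ (Fin n)) θ,
      inner ℝ ω (v θ) = (r * ω i) * Real.cos θ + (r * ω j) * Real.sin θ := fun ω θ => by
    simp only [v, inner_add_right, EuclideanSpace.inner_single_right]
    simp
    ring
  set I := ∫ ω, (1 - Real.cos (inner ℝ (ω : EuclideanSpace ℝ (Fin n)) ξ)) ∂(sphereProb n)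
  have hθ : ∀ θ, ∫ ω, (1 - Real.cos (r * (ω : EuclideanSpace ℝ (Fin n)) i * Real.cos θ +
      r * (ω : EuclideanSpace ℝ (Fin n)) j * Real.sin θ)) ∂(sphereProb n) = I := fun θ => by
    simp only [← hinner]
    exact integral_sphere_inner_congr (fun x => 1 - Real.cos x) (by fun_prop) (hv θ)
  have hswap : 2 * Real.pi * I = ∫ ω, (∫ θ in (0 : ℝ)..(2 * Real.pi),
      (1 - Real.cos (r * (ω : EuclideanSpace ℝ (Fin n)) i * Real.cos θ +
        r * (ω : EuclideanSpace ℝ (Fin n)) j * Real.sin θ))) ∂(sphereProb n) := by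
    rw [← intervalIntegral_integral_swap]
    · simp [hθ]
    · have hfin : IsFiniteMeasure ((volume : Measure ℝ).restrict
          (Set.uIoc (0 : ℝ) (2 * Real.pi))) := by
        rw [Set.uIoc]; infer_instance
      refine Integrable.of_bound (C := 2) (Continuous.aestronglyMeasurable ?_)
        (Filter.Eventually.of_forall fun p => ?_)
      · simp only [Function.uncurry_def]; fun_prop
      · simp only [Function.uncurry_def, Real.norm_eq_abs]
        rw [abs_le]
        constructor <;>
          linarith [Real.cos_le_one (r * (p.2 : EuclideanSpace ℝ (Fin n)) i * Real.cos p.1 +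
              r * (p.2 : EuclideanSpace ℝ (Fin n)) j * Real.sin p.1),
            Real.neg_one_le_cos (r * (p.2 : EuclideanSpace ℝ (Fin n)) i * Real.cos p.1 +
              r * (p.2 : EuclideanSpace ℝ (Fin n)) j * Real.sin p.1)]
  have hlow : ∫ ω, (1 / 50 * min 1 (r ^ 2)) * (ω : EuclideanSpace ℝ (Fin n)) i ^ 2 ∂(sphereProb n)
      ≤ 2 * Real.pi * I := by
    rw [hswap]
    refine integral_mono (integrable_sphere
        (h := fun ω : EuclideanSpace ℝ (Fin n) => (1 / 50 * min 1 (r ^ 2)) * ω i ^ 2) hn1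
        (by fun_prop)) (integrable_sphere (h := fun ω : EuclideanSpace ℝ (Fin n) =>
        ∫ θ in (0 : ℝ)..(2 * Real.pi), (1 - Real.cos (r * ω i * Real.cos θ +
          r * ω j * Real.sin θ))) hn1 ?_) fun ω => ?_
    · exact intervalIntegral.continuous_parametric_intervalIntegral_of_continuous'
        (by simp only [Function.uncurry_def]; fun_prop) _ _
    · refine le_trans ?_ (le_integral_one_sub_cos_circle _ _)
      set a := (ω : EuclideanSpace ℝ (Fin n)) i
      set b := (ω : EuclideanSpace ℝ (Fin n)) j
      have ha : a ^ 2 ≤ 1 := by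
        have : ‖a‖ ≤ ‖(ω : EuclideanSpace ℝ (Fin n))‖ := PiLp.norm_apply_le _ i
        rw [norm_eq_of_mem_sphere, Real.norm_eq_abs] at this
        exact (sq_le_one_iff_abs_le_one a).2 this
      have hm : min 1 (r ^ 2) * a ^ 2 ≤ min 1 ((r * a) ^ 2 + (r * b) ^ 2) := by
        refine le_min ?_ ?_
        · exact mul_le_one₀ (min_le_left _ _) (sq_nonneg a) ha
        · have := mul_le_mul_of_nonneg_right (min_le_right 1 (r ^ 2)) (sq_nonneg a)
          nlinarith [sq_nonneg (r * b)]
      linarith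
  rw [integral_const_mul, integral_sphere_coord_sq hn1] at hlow
  have hpi := Real.pi_pos
  have hn0 : (0 : ℝ) < n := by positivity
  calc 1 / (100 * Real.pi * n) * min 1 (r ^ 2)
      = (1 / 50 * min 1 (r ^ 2) * (1 / n)) / (2 * Real.pi) := by field_simp; ring
    _ ≤ I := by rw [div_le_iff₀ (by positivity)]; linarith

theorem integral_one_sub_cos_sphere_le {n : ℕ} (hn : 1 ≤ n) (ξ : EuclideanSpace ℝ (Fin n)) :
    ∫ ω, (1 - Real.cos (inner ℝ (ω : EuclideanSpace ℝ (Fin n)) ξ)) ∂(sphereProb n) ≤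
      2 * min 1 (‖ξ‖ ^ 2) := by
  have := isProbabilityMeasure_sphereProb hn
  have h : ∫ ω, (1 - Real.cos (inner ℝ (ω : EuclideanSpace ℝ (Fin n)) ξ)) ∂(sphereProb n) ≤
      ∫ _, 2 * min 1 (‖ξ‖ ^ 2) ∂(sphereProb n) := by
    refine integral_mono (integrable_sphere (h := fun ω : EuclideanSpace ℝ (Fin n) =>
      1 - Real.cos (inner ℝ ω ξ)) hn (by fun_prop)) (integrable_const _) fun ω => ?_
    set x := inner ℝ (ω : EuclideanSpace ℝ (Fin n)) ξ
    have hx : |x| ≤ ‖ξ‖ := by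
      have := abs_real_inner_le_norm (ω : EuclideanSpace ℝ (Fin n)) ξ
      rwa [norm_eq_of_mem_sphere, one_mul] at this
    have hx2 : x ^ 2 ≤ ‖ξ‖ ^ 2 := sq_le_sq' (abs_le.1 hx).1 (abs_le.1 hx).2
    have := Real.one_sub_sq_div_two_le_cos (x := x)
    rcases min_choice 1 (‖ξ‖ ^ 2) with h | h <;> rw [h]
    · linarith [Real.neg_one_le_cos x]
    · nlinarith [sq_nonneg x]
  simpa using h

/-- The Fourier multiplier of the spherical mean: the (inverse) Fourier transform of the normalized
surface measure. It is real and even, and written with `cos`. -/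
noncomputable def sphereMultiplier {n : ℕ} (ξ : EuclideanSpace ℝ (Fin n)) : ℝ :=
  ∫ ω, Real.cos (inner ℝ (ω : EuclideanSpace ℝ (Fin n)) ξ) ∂(sphereProb n)

theorem integral_one_sub_cos_sphere {n : ℕ} (hn : 1 ≤ n) (ξ : EuclideanSpace ℝ (Fin n)) :
    ∫ ω, (1 - Real.cos (inner ℝ (ω : EuclideanSpace ℝ (Fin n)) ξ)) ∂(sphereProb n) =
      1 - sphereMultiplier ξ := by
  have := isProbabilityMeasure_sphereProb hn
  rw [integral_sub (integrable_const _) (integrable_sphere (h := fun ω : EuclideanSpace ℝ (Fin n) =>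
      Real.cos (inner ℝ ω ξ)) hn (by fun_prop))]
  simp [sphereMultiplier]

theorem integral_exp_sphere {n : ℕ} (hn : 1 ≤ n) (ξ : EuclideanSpace ℝ (Fin n)) :
    ∫ ω, Complex.exp (Complex.I * ((inner ℝ (ω : EuclideanSpace ℝ (Fin n)) ξ : ℝ) : ℂ))
      ∂(sphereProb n) = sphereMultiplier ξ := by
  have hsin : ∫ ω, Real.sin (inner ℝ (ω : EuclideanSpace ℝ (Fin n)) ξ) ∂(sphereProb n) = 0 := by
    have h := integral_sphere_inner_congr (n := n) Real.sin (by fun_prop) (ξ := -ξ) (η := ξ)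
      (norm_neg ξ)
    simp only [inner_neg_right, Real.sin_neg, integral_neg] at h
    linarith
  have hexp : ∀ x : ℝ, Complex.exp (Complex.I * (x : ℂ)) =
      ((Real.cos x : ℝ) : ℂ) + Complex.I * ((Real.sin x : ℝ) : ℂ) := fun x => by
    rw [mul_comm, Complex.exp_mul_I]; push_cast; ring
  simp only [hexp]
  rw [integral_add]
  · rw [integral_const_mul, integral_complex_ofReal, integral_complex_ofReal, hsin]
    simp [sphereMultiplier]
  · exact integrable_sphere (h := fun ω : EuclideanSpace ℝ (Fin n) =>
      ((Real.cos (inner ℝ ω ξ) : ℝ) : ℂ)) hn (by fun_prop)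
  · exact integrable_sphere (h := fun ω : EuclideanSpace ℝ (Fin n) =>
      Complex.I * ((Real.sin (inner ℝ ω ξ) : ℝ) : ℂ)) hn (by fun_prop)

theorem le_one_sub_sphereMultiplier {n : ℕ} (hn : 2 ≤ n) (ξ : EuclideanSpace ℝ (Fin n)) :
    1 / (100 * Real.pi * n) * min 1 (‖ξ‖ ^ 2) ≤ 1 - sphereMultiplier ξ :=
  (le_integral_one_sub_cos_sphere hn ξ).trans_eq (integral_one_sub_cos_sphere (by lia) ξ)

theorem one_sub_sphereMultiplier_le {n : ℕ} (hn : 1 ≤ n) (ξ : EuclideanSpace ℝ (Fin n)) :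
    1 - sphereMultiplier ξ ≤ 2 * min 1 (‖ξ‖ ^ 2) :=
  (integral_one_sub_cos_sphere hn ξ).symm.trans_le (integral_one_sub_cos_sphere_le hn ξ)

theorem abs_sphereMultiplier_le_one {n : ℕ} (hn : 1 ≤ n) (ξ : EuclideanSpace ℝ (Fin n)) :
    |sphereMultiplier ξ| ≤ 1 := by
  have := isProbabilityMeasure_sphereProb hn
  have := norm_integral_le_of_norm_le_const (μ := sphereProb n) (C := 1)
    (f := fun ω => Real.cos (inner ℝ (ω : EuclideanSpace ℝ (Fin n)) ξ))
    (Filter.Eventually.of_forall fun ω => Real.abs_cos_le_one _)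
  simpa [sphereMultiplier] using this

theorem continuous_sphereMultiplier {n : ℕ} (hn : 1 ≤ n) :
    Continuous (sphereMultiplier : EuclideanSpace ℝ (Fin n) → ℝ) := by
  have := isProbabilityMeasure_sphereProb hn
  refine continuous_of_dominated (bound := fun _ => 1) (fun ξ => ?_)
    (fun ξ => Filter.Eventually.of_forall fun ω => Real.abs_cos_le_one _) (integrable_const _)
    (Filter.Eventually.of_forall fun ω => by fun_prop)
  exact Continuous.aestronglyMeasurable (by fun_prop)

/-! ### Spherical means of `L^p` functions -/

/-- Each slice `x ↦ x + t • ω` preserves Lebesgue measure, and the sphere has total mass one. Through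
this map the null sets and `L^p` norms of `f` control those of its restrictions to spheres. -/
theorem measurePreserving_add_smul_sphere {n : ℕ} (hn : 1 ≤ n) (t : ℝ) :
    MeasurePreserving
      (fun z : EuclideanSpace ℝ (Fin n) × Metric.sphere (0 : EuclideanSpace ℝ (Fin n)) 1 =>
        z.1 + t • (z.2 : EuclideanSpace ℝ (Fin n))) (volume.prod (sphereProb n)) volume := by
  have := isProbabilityMeasure_sphereProb hn
  have h : MeasurePreserving
      (fun z : Metric.sphere (0 : EuclideanSpace ℝ (Fin n)) 1 × EuclideanSpace ℝ (Fin n) =>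
        (id z.1, z.2 + t • (z.1 : EuclideanSpace ℝ (Fin n))))
      ((sphereProb n).prod volume) ((sphereProb n).prod volume) :=
    (MeasurePreserving.id _).skew_product 
      (g := fun (ω : Metric.sphere (0 : EuclideanSpace ℝ (Fin n)) 1) x =>
        x + t • (ω : EuclideanSpace ℝ (Fin n)))
      (Continuous.measurable (by simp only [Function.uncurry_def]; fun_prop))
      (Filter.Eventually.of_forall fun ω =>
        (measurePreserving_add_right volume (t • (ω : EuclideanSpace ℝ (Fin n)))).map_eq)
  exact (measurePreserving_snd.comp h).comp Measure.measurePreserving_swap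

section Slices

variable {n : ℕ} {t : ℝ} {f : EuclideanSpace ℝ (Fin n) → ℂ}

theorem aestronglyMeasurable_slices (hn : 1 ≤ n) (hf : AEStronglyMeasurable f volume) (t : ℝ) :
    AEStronglyMeasurable
      (fun z : EuclideanSpace ℝ (Fin n) × Metric.sphere (0 : EuclideanSpace ℝ (Fin n)) 1 =>
        f (z.1 + t • (z.2 : EuclideanSpace ℝ (Fin n)))) (volume.prod (sphereProb n)) :=
  hf.comp_measurePreserving (measurePreserving_add_smul_sphere hn t)

theorem aestronglyMeasurable_sphericalMean (hn : 1 ≤ n) (hf : AEStronglyMeasurable f volume)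
    (t : ℝ) : AEStronglyMeasurable (sphericalMean t f) volume := by
  have := isProbabilityMeasure_sphereProb hn
  exact (aestronglyMeasurable_slices hn hf t).integral_prod_right'

theorem lintegral_lintegral_sphere_rpow (hn : 1 ≤ n) (hf : AEStronglyMeasurable f volume)
    (t p : ℝ) :
    ∫⁻ x, ∫⁻ ω, ‖f (x + t • (ω : EuclideanSpace ℝ (Fin n)))‖ₑ ^ p ∂(sphereProb n) =
      ∫⁻ x, ‖f x‖ₑ ^ p := by
  have := isProbabilityMeasure_sphereProb hn
  have hmp := measurePreserving_add_smul_sphere hn t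
  have hm : AEMeasurable (fun x => ‖f x‖ₑ ^ p) volume := hf.enorm.pow_const p
  rw [← lintegral_prod (μ := volume) (ν := sphereProb n)
    (fun z => ‖f (z.1 + t • (z.2 : EuclideanSpace ℝ (Fin n)))‖ₑ ^ p)
    ((aestronglyMeasurable_slices hn hf t).enorm.pow_const p)]
  conv_rhs => rw [← hmp.map_eq]
  rw [lintegral_map' (by rwa [hmp.map_eq]) hmp.aemeasurable]

theorem ae_memLp_slices (hn : 1 ≤ n) {p : ℝ≥0∞} (hp0 : p ≠ 0) (hpt : p ≠ ⊤)
    (hf : MemLp f p volume) (t : ℝ) :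
    ∀ᵐ x, MemLp (fun ω : Metric.sphere (0 : EuclideanSpace ℝ (Fin n)) 1 =>
      f (x + t • (ω : EuclideanSpace ℝ (Fin n)))) p (sphereProb n) := by
  have := isProbabilityMeasure_sphereProb hn
  have hsl := aestronglyMeasurable_slices hn hf.1 t
  have hfin : ∫⁻ x, ∫⁻ ω, ‖f (x + t • (ω : EuclideanSpace ℝ (Fin n)))‖ₑ ^ p.toReal
      ∂(sphereProb n) ≠ ⊤ := by
    rw [lintegral_lintegral_sphere_rpow hn hf.1]
    exact (lintegral_rpow_enorm_lt_top_of_eLpNorm_lt_top hp0 hpt hf.2).ne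
  filter_upwards [hsl.prodMk_left,
    ae_lt_top' (hsl.enorm.pow_const p.toReal).lintegral_prod_right' hfin] with x hx hx'
  exact ⟨hx, (eLpNorm_lt_top_iff_lintegral_rpow_enorm_lt_top hp0 hpt).2 hx'⟩

theorem ae_integrable_slices (hn : 1 ≤ n) {p : ℝ≥0∞} (hp1 : 1 ≤ p) (hpt : p ≠ ⊤)
    (hf : MemLp f p volume) (t : ℝ) :
    ∀ᵐ x, Integrable (fun ω : Metric.sphere (0 : EuclideanSpace ℝ (Fin n)) 1 =>
      f (x + t • (ω : EuclideanSpace ℝ (Fin n)))) (sphereProb n) := by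
  have := isProbabilityMeasure_sphereProb hn
  filter_upwards [ae_memLp_slices hn (by positivity) hpt hf t] with x hx
  exact hx.integrable hp1

/-- Jensen's inequality on each sphere. -/
theorem eLpNorm_sphericalMean_le (hn : 1 ≤ n) {p : ℝ≥0∞} (hp1 : 1 ≤ p) (hpt : p ≠ ⊤)
    (hf : MemLp f p volume) (t : ℝ) :
    eLpNorm (sphericalMean t f) p volume ≤ eLpNorm f p volume := by
  have := isProbabilityMeasure_sphereProb hn
  have hp0 : p ≠ 0 := by positivity
  have hpr : 0 < p.toReal := ENNReal.toReal_pos hp0 hpt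
  rw [eLpNorm_eq_lintegral_rpow_enorm_toReal hp0 hpt,
    eLpNorm_eq_lintegral_rpow_enorm_toReal hp0 hpt]
  refine ENNReal.rpow_le_rpow ?_ (by positivity)
  rw [← lintegral_lintegral_sphere_rpow hn hf.1 t]
  refine lintegral_mono_ae ?_
  filter_upwards [ae_memLp_slices hn hp0 hpt hf t] with x hx
  have h1 : ‖sphericalMean t f x‖ₑ ≤
      eLpNorm (fun ω : Metric.sphere (0 : EuclideanSpace ℝ (Fin n)) 1 =>
        f (x + t • (ω : EuclideanSpace ℝ (Fin n)))) p (sphereProb n) := by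
    refine le_trans ?_ (eLpNorm_le_eLpNorm_of_exponent_le hp1 hx.1)
    rw [sphericalMean_eq, eLpNorm_one_eq_lintegral_enorm]
    exact enorm_integral_le_lintegral_enorm _
  refine (ENNReal.rpow_le_rpow h1 hpr.le).trans_eq ?_
  rw [eLpNorm_eq_lintegral_rpow_enorm_toReal hp0 hpt, ← ENNReal.rpow_mul,
    one_div_mul_cancel hpr.ne', ENNReal.rpow_one]

theorem memLp_sphericalMean (hn : 1 ≤ n) {p : ℝ≥0∞} (hp1 : 1 ≤ p) (hpt : p ≠ ⊤)
    (hf : MemLp f p volume) (t : ℝ) : MemLp (sphericalMean t f) p volume :=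
  ⟨aestronglyMeasurable_sphericalMean hn hf.1 t,
    (eLpNorm_sphericalMean_le hn hp1 hpt hf t).trans_lt hf.2⟩

theorem memLp_sphericalMean_sub (hn : 1 ≤ n) {p : ℝ≥0∞} (hp1 : 1 ≤ p) (hpt : p ≠ ⊤)
    (hf : MemLp f p volume) (t : ℝ) : MemLp (fun x => sphericalMean t f x - f x) p volume :=
  (memLp_sphericalMean hn hp1 hpt hf t).sub hf

theorem ae_sphericalMean_add (hn : 1 ≤ n) {g : EuclideanSpace ℝ (Fin n) → ℂ} {p q : ℝ≥0∞}
    (hp1 : 1 ≤ p) (hpt : p ≠ ⊤) (hq1 : 1 ≤ q) (hqt : q ≠ ⊤)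
    (hf : MemLp f p volume) (hg : MemLp g q volume) (t : ℝ) :
    sphericalMean t (f + g) =ᵐ[volume] sphericalMean t f + sphericalMean t g := by
  filter_upwards [ae_integrable_slices hn hp1 hpt hf t, ae_integrable_slices hn hq1 hqt hg t]
    with x hx hx'
  simp only [sphericalMean_eq, Pi.add_apply]
  exact integral_add hx hx'

end Slices

/-! ### The Fourier transform on `L¹` and on `L²` -/

section FourierL1

variable {n : ℕ} {f g : EuclideanSpace ℝ (Fin n) → ℂ}

theorem integrable_fourierL1_kernel (hf : Integrable f) (ξ : EuclideanSpace ℝ (Fin n)) :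
    Integrable fun x => Complex.exp (-Complex.I * ((inner ℝ x ξ : ℝ) : ℂ)) * f x := by
  refine hf.bdd_mul (c := 1) (Continuous.aestronglyMeasurable (by fun_prop))
    (Filter.Eventually.of_forall fun x => ?_)
  rw [neg_mul, mul_comm, ← neg_mul, ← Complex.ofReal_neg, Complex.norm_exp_ofReal_mul_I]

theorem fourierL1_sub (hf : Integrable f) (hg : Integrable g) :
    fourierL1 (f - g) = fourierL1 f - fourierL1 g := by
  ext ξ
  simp only [fourierL1, Pi.sub_apply, mul_sub]
  exact integral_sub (integrable_fourierL1_kernel hf ξ) (integrable_fourierL1_kernel hg ξ)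

theorem enorm_fourierL1_le (f : EuclideanSpace ℝ (Fin n) → ℂ) (ξ : EuclideanSpace ℝ (Fin n)) :
    ‖fourierL1 f ξ‖ₑ ≤ eLpNorm f 1 volume := by
  rw [eLpNorm_one_eq_lintegral_enorm]
  refine (enorm_integral_le_lintegral_enorm _).trans_eq (lintegral_congr fun x => ?_)
  rw [enorm_mul, neg_mul, mul_comm Complex.I, ← neg_mul, ← Complex.ofReal_neg,
    ← ofReal_norm, Complex.norm_exp_ofReal_mul_I]
  simp

theorem continuous_fourierL1 (hf : Integrable f) : Continuous (fourierL1 f) := by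
  have h : fourierL1 f = fun ξ => 𝓕 f ((2 * Real.pi)⁻¹ • ξ) := funext fun ξ => fourierL1_eq f ξ
  have hc : Continuous (𝓕 f) := VectorFourier.fourierIntegral_continuous
    Real.continuous_fourierChar continuous_inner hf
  rw [h]
  fun_prop

theorem fourierL1_comp_add_right (f : EuclideanSpace ℝ (Fin n) → ℂ)
    (v ξ : EuclideanSpace ℝ (Fin n)) :
    fourierL1 (fun x => f (x + v)) ξ =
      Complex.exp (Complex.I * ((inner ℝ v ξ : ℝ) : ℂ)) * fourierL1 f ξ := by
  simp only [fourierL1]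
  rw [← integral_const_mul, ← integral_add_right_eq_self (fun x =>
    Complex.exp (Complex.I * ((inner ℝ v ξ : ℝ) : ℂ)) *
      (Complex.exp (-Complex.I * ((inner ℝ x ξ : ℝ) : ℂ)) * f x)) v]
  refine integral_congr_ae (Filter.Eventually.of_forall fun x => ?_)
  simp only
  rw [← mul_assoc, ← Complex.exp_add, inner_add_left]
  congr 2
  push_cast
  ring

theorem fourierL1_sphericalMean (hn : 1 ≤ n) (hf : Integrable f) (t : ℝ)
    (ξ : EuclideanSpace ℝ (Fin n)) :
    fourierL1 (sphericalMean t f) ξ = sphereMultiplier (t • ξ) * fourierL1 f ξ := by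
  have := isProbabilityMeasure_sphereProb hn
  have hint : Integrable (fun z : EuclideanSpace ℝ (Fin n) ×
      Metric.sphere (0 : EuclideanSpace ℝ (Fin n)) 1 =>
        Complex.exp (-Complex.I * ((inner ℝ z.1 ξ : ℝ) : ℂ)) *
          f (z.1 + t • (z.2 : EuclideanSpace ℝ (Fin n)))) (volume.prod (sphereProb n)) := by
    refine Integrable.bdd_mul (c := 1)
      ((measurePreserving_add_smul_sphere hn t).integrable_comp_of_integrable hf)
      (Continuous.aestronglyMeasurable (by fun_prop)) (Filter.Eventually.of_forall fun z => ?_)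
    rw [neg_mul, mul_comm, ← neg_mul, ← Complex.ofReal_neg, Complex.norm_exp_ofReal_mul_I]
  have hswap := integral_integral_swap (μ := volume) (ν := sphereProb n)
    (f := fun x ω => Complex.exp (-Complex.I * ((inner ℝ x ξ : ℝ) : ℂ)) *
          f (x + t • (ω : EuclideanSpace ℝ (Fin n)))) hint
  simp only [integral_const_mul] at hswap
  calc fourierL1 (sphericalMean t f) ξ = _ := hswap
    _ = ∫ ω, Complex.exp (Complex.I *
          ((inner ℝ (ω : EuclideanSpace ℝ (Fin n)) (t • ξ) : ℝ) : ℂ)) * fourierL1 f ξ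
            ∂(sphereProb n) := by
        refine integral_congr_ae (Filter.Eventually.of_forall fun ω => ?_)
        have := fourierL1_comp_add_right f (t • (ω : EuclideanSpace ℝ (Fin n))) ξ
        rw [real_inner_smul_left, ← real_inner_smul_right] at this
        exact this
    _ = _ := by rw [integral_mul_const, integral_exp_sphere hn]

end FourierL1

section FourierL2

variable {n : ℕ} {f g : EuclideanSpace ℝ (Fin n) → ℂ}

/-- The Jacobian of the dilation between the two normalizations of the Fourier transform. -/
noncomputable def dilationConst (n : ℕ) : ℝ≥0∞ :=
  ENNReal.ofReal |((2 * Real.pi)⁻¹ ^ n)⁻¹|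

theorem dilationConst_ne_zero (n : ℕ) : dilationConst n ≠ 0 := by
  have := Real.pi_pos
  simp only [dilationConst, ne_eq, ENNReal.ofReal_eq_zero, not_le]
  positivity

theorem dilationConst_ne_top (n : ℕ) : dilationConst n ≠ ⊤ := ENNReal.ofReal_ne_top

theorem map_dilation (n : ℕ) :
    Measure.map (fun ξ : EuclideanSpace ℝ (Fin n) => (2 * Real.pi)⁻¹ • ξ) volume =
      dilationConst n • volume := by
  have := Measure.map_addHaar_smul (volume : Measure (EuclideanSpace ℝ (Fin n)))
    (r := (2 * Real.pi)⁻¹) (by positivity)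
  simpa [dilationConst] using this

theorem quasiMeasurePreserving_dilation (n : ℕ) :
    Measure.QuasiMeasurePreserving
      (fun ξ : EuclideanSpace ℝ (Fin n) => (2 * Real.pi)⁻¹ • ξ) volume volume :=
  ⟨by fun_prop, by
    rw [map_dilation]; exact Measure.smul_absolutelyContinuous⟩

theorem eLpNorm_comp_dilation {h : EuclideanSpace ℝ (Fin n) → ℂ}
    (hh : AEStronglyMeasurable h volume) :
    eLpNorm (fun ξ => h ((2 * Real.pi)⁻¹ • ξ)) 2 volume =
      dilationConst n ^ (1 / 2 : ℝ) * eLpNorm h 2 volume := by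
  have hh' : AEStronglyMeasurable h (dilationConst n • volume) := hh.smul_measure _
  have h1 := eLpNorm_map_measure (p := 2) (μ := volume)
    (f := fun ξ : EuclideanSpace ℝ (Fin n) => (2 * Real.pi)⁻¹ • ξ) (g := h)
    (by rwa [map_dilation]) (by fun_prop)
  rw [map_dilation] at h1
  refine h1.symm.trans ?_
  rw [eLpNorm_smul_measure_of_ne_top (by norm_num)]
  simp

theorem fourierL2_eq (hf : MemLp f 2 volume) :
    fourierL2 f = fun ξ => (𝓕 (hf.toLp f) : Lp ℂ 2 (volume : Measure (EuclideanSpace ℝ (Fin n))))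
      ((2 * Real.pi)⁻¹ • ξ) := by
  ext ξ
  simp only [fourierL2, hf, dif_pos]

theorem memLp_fourierL2 (hf : MemLp f 2 volume) : MemLp (fourierL2 f) 2 volume := by
  have hm := (Lp.memLp (𝓕 (hf.toLp f) : Lp ℂ 2 (volume : Measure (EuclideanSpace ℝ (Fin n)))))
  rw [fourierL2_eq hf]
  refine ⟨hm.1.comp_quasiMeasurePreserving (quasiMeasurePreserving_dilation n), ?_⟩
  rw [eLpNorm_comp_dilation hm.1]
  exact ENNReal.mul_lt_top
    (ENNReal.rpow_lt_top_of_nonneg (by norm_num) (dilationConst_ne_top n)) hm.2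

/-- Plancherel's theorem in the normalization of `fourierL2`. -/
theorem eLpNorm_fourierL2 (hf : MemLp f 2 volume) :
    eLpNorm (fourierL2 f) 2 volume = dilationConst n ^ (1 / 2 : ℝ) * eLpNorm f 2 volume := by
  have hm := (Lp.memLp (𝓕 (hf.toLp f) : Lp ℂ 2 (volume : Measure (EuclideanSpace ℝ (Fin n)))))
  rw [fourierL2_eq hf, eLpNorm_comp_dilation hm.1]
  have h1 := Lp.norm_fourier_eq (hf.toLp f)
  rw [Lp.norm_def, Lp.norm_def, ENNReal.toReal_eq_toReal_iff' hm.2.ne (Lp.memLp _).2.ne] at h1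
  rw [h1, eLpNorm_congr_ae hf.coeFn_toLp]

theorem fourierL2_congr (h : f =ᵐ[volume] g) : fourierL2 f = fourierL2 g := by
  ext ξ
  by_cases hf : MemLp f 2 volume
  · have hg : MemLp g 2 volume := hf.ae_eq h
    have : hf.toLp f = hg.toLp g := (MemLp.toLp_eq_toLp_iff hf hg).2 h
    rw [fourierL2_eq hf, fourierL2_eq hg, this]
  · have hg : ¬ MemLp g 2 volume := fun hg => hf (hg.ae_eq h.symm)
    simp only [fourierL2, hf, hg, dif_neg, not_false_eq_true]

theorem fourierL2_add (hf : MemLp f 2 volume) (hg : MemLp g 2 volume) :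
    fourierL2 (f + g) =ᵐ[volume] fourierL2 f + fourierL2 g := by
  rw [fourierL2_eq hf, fourierL2_eq hg, fourierL2_eq (hf.add hg)]
  refine (quasiMeasurePreserving_dilation n).ae_eq_comp (g := _)
    (g' := fun η => (𝓕 (hf.toLp f) : Lp ℂ 2 (volume : Measure (EuclideanSpace ℝ (Fin n)))) η +
      (𝓕 (hg.toLp g) : Lp ℂ 2 (volume : Measure (EuclideanSpace ℝ (Fin n)))) η) ?_
  rw [MemLp.toLp_add, FourierTransform.fourier_add]
  exact Lp.coeFn_add _ _

theorem fourierL2_sub (hf : MemLp f 2 volume) (hg : MemLp g 2 volume) :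
    fourierL2 (f - g) =ᵐ[volume] fourierL2 f - fourierL2 g := by
  have h := fourierL2_add (hf.sub hg) hg
  rw [sub_add_cancel] at h
  filter_upwards [h] with ξ hξ
  simp [hξ]

end FourierL2

section Consistency

variable {n : ℕ} {f : EuclideanSpace ℝ (Fin n) → ℂ}

/-- Both transforms are adjoint to the Fourier transform of Schwartz functions. -/
theorem fourierL2_ae_eq_fourierL1 (hf1 : Integrable f) (hf2 : MemLp f 2 volume) :
    fourierL2 f =ᵐ[volume] fourierL1 f := by
  have h1 : fourierL1 f = fun ξ => 𝓕 f ((2 * Real.pi)⁻¹ • ξ) := funext fun ξ => fourierL1_eq f ξ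
  rw [fourierL2_eq hf2, h1]
  refine (quasiMeasurePreserving_dilation n).ae_eq_comp (g := _) (g' := 𝓕 f) ?_
  have hc : Continuous (𝓕 f) := VectorFourier.fourierIntegral_continuous
    Real.continuous_fourierChar continuous_inner hf1
  refine ae_eq_of_integral_contDiff_smul_eq
    ((Lp.memLp _).locallyIntegrable (by norm_num)) hc.locallyIntegrable fun g hg hgc => ?_
  let φ : SchwartzMap (EuclideanSpace ℝ (Fin n)) ℂ :=
    HasCompactSupport.toSchwartzMap (f := fun x => (g x : ℂ))
      (hgc.comp_left (g := fun r : ℝ => (r : ℂ)) Complex.ofReal_zero)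
      (Complex.ofRealCLM.contDiff.comp hg)
  have hφ : ∀ x, φ x = g x := fun x => rfl
  have hdist := congrArg (fun T => T φ) (Lp.fourier_toTemperedDistribution_eq (hf2.toLp f))
  simp only [TemperedDistribution.fourier_apply, Lp.toTemperedDistribution_apply] at hdist
  have hflip := VectorFourier.integral_fourierIntegral_smul_eq_flip
    (L := innerₗ (EuclideanSpace ℝ (Fin n))) (μ := volume) (ν := volume) (f := φ) (g := f)
    Real.continuous_fourierChar continuous_inner φ.integrable hf1
  rw [flip_innerₗ] at hflip
  have hflip' : ∫ x, (𝓕 φ) x • f x = ∫ x, φ x • 𝓕 f x := hflip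
  calc ∫ x, g x • (𝓕 (hf2.toLp f) : Lp ℂ 2 (volume : Measure (EuclideanSpace ℝ (Fin n)))) x
      = ∫ x, φ x • (𝓕 (hf2.toLp f) : Lp ℂ 2 (volume : Measure (EuclideanSpace ℝ (Fin n)))) x := by
        simp only [hφ, smul_eq_mul, Complex.real_smul]
    _ = ∫ x, (𝓕 φ) x • hf2.toLp f x := hdist.symm
    _ = ∫ x, (𝓕 φ) x • f x := by
        refine integral_congr_ae ?_
        filter_upwards [hf2.coeFn_toLp] with x hx
        rw [hx]
    _ = ∫ x, φ x • 𝓕 f x := hflip'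
    _ = ∫ x, g x • 𝓕 f x := by simp only [hφ, smul_eq_mul, Complex.real_smul]

end Consistency

/-! ### The multiplier of the spherical mean on `L²` -/

section MultiplierL2

variable {n : ℕ} {f : EuclideanSpace ℝ (Fin n) → ℂ}

theorem fourierL2_sphericalMean_of_integrable (hn : 1 ≤ n) (hf1 : Integrable f)
    (hf2 : MemLp f 2 volume) (t : ℝ) :
    fourierL2 (sphericalMean t f) =ᵐ[volume]
      fun ξ => sphereMultiplier (t • ξ) * fourierL2 f ξ := by
  have hM1 := memLp_one_iff_integrable.1
    (memLp_sphericalMean hn le_rfl (by norm_num) (memLp_one_iff_integrable.2 hf1) t)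
  have hM2 := memLp_sphericalMean hn (by norm_num) (by norm_num) hf2 t
  filter_upwards [fourierL2_ae_eq_fourierL1 hM1 hM2, fourierL2_ae_eq_fourierL1 hf1 hf2] with ξ h1 h2
  rw [h1, h2, fourierL1_sphericalMean hn hf1]

/-- The identity passes from continuous functions of compact support to all of `L²`: the difference
of the two sides is a linear operator, bounded on `L²`. -/
theorem fourierL2_sphericalMean (hn : 1 ≤ n) (hf : MemLp f 2 volume) (t : ℝ) :
    fourierL2 (sphericalMean t f) =ᵐ[volume]
      fun ξ => sphereMultiplier (t • ξ) * fourierL2 f ξ := by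
  have h12 : (1 : ℝ≥0∞) ≤ 2 := by norm_num
  have h2t : (2 : ℝ≥0∞) ≠ ⊤ := by norm_num
  have hmc : Continuous fun ξ : EuclideanSpace ℝ (Fin n) =>
      ((sphereMultiplier (t • ξ) : ℝ) : ℂ) :=
    Complex.continuous_ofReal.comp ((continuous_sphereMultiplier hn).comp (by fun_prop))
  let d : (EuclideanSpace ℝ (Fin n) → ℂ) → EuclideanSpace ℝ (Fin n) → ℂ := fun g =>
    fourierL2 (sphericalMean t g) - fun ξ => sphereMultiplier (t • ξ) * fourierL2 g ξ
  have hmeas : ∀ {g}, MemLp g 2 volume → AEStronglyMeasurable (d g) volume := fun {g} hg =>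
    (memLp_fourierL2 (memLp_sphericalMean hn h12 h2t hg t)).1.sub
      (hmc.aestronglyMeasurable.mul (memLp_fourierL2 hg).1)
  set K := dilationConst n ^ (1 / 2 : ℝ)
  have hKt : K ≠ ⊤ := ENNReal.rpow_ne_top_of_nonneg (by norm_num) (dilationConst_ne_top n)
  have hbound : ∀ {g}, MemLp g 2 volume → eLpNorm (d g) 2 volume ≤ 2 * K * eLpNorm g 2 volume := by
    intro g hg
    have hMg := memLp_sphericalMean hn h12 h2t hg t
    refine (eLpNorm_sub_le (memLp_fourierL2 hMg).1
      (hmc.aestronglyMeasurable.mul (memLp_fourierL2 hg).1) h12).trans ?_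
    rw [two_mul, add_mul]
    refine add_le_add ?_ ?_
    · rw [eLpNorm_fourierL2 hMg]
      gcongr
      exact eLpNorm_sphericalMean_le hn h12 h2t hg t
    · rw [← eLpNorm_fourierL2 hg]
      refine eLpNorm_mono fun ξ => ?_
      rw [Pi.mul_apply, norm_mul, Complex.norm_real]
      exact mul_le_of_le_one_left (norm_nonneg _) (abs_sphereMultiplier_le_one hn _)
  have hsmall : ∀ ε : ℝ≥0∞, ε ≠ 0 → eLpNorm (d f) 2 volume ≤ 2 * K * ε := by
    intro ε hε
    obtain ⟨h, hhc, hhε, hhcont, hh2⟩ := hf.exists_hasCompactSupport_eLpNorm_sub_le h2t hε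
    have hh1 : Integrable h := hhcont.integrable_of_hasCompactSupport hhc
    have hsub := hf.sub hh2
    have hdd : d f =ᵐ[volume] d (f - h) := by
      have hMsplit := ae_sphericalMean_add hn h12 h2t h12 h2t hsub hh2 t
      rw [sub_add_cancel] at hMsplit
      have hF := fourierL2_add (memLp_sphericalMean hn h12 h2t hsub t)
        (memLp_sphericalMean hn h12 h2t hh2 t)
      rw [← fourierL2_congr hMsplit] at hF
      filter_upwards [hF, fourierL2_sub hf hh2,
        fourierL2_sphericalMean_of_integrable hn hh1 hh2 t] with ξ e1 e2 e3
      simp only [d, Pi.sub_apply, Pi.add_apply] at *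
      rw [e1, e2, e3]
      ring
    rw [eLpNorm_congr_ae hdd]
    exact (hbound hsub).trans (by gcongr)
  have hzero : eLpNorm (d f) 2 volume = 0 := by
    by_contra hne
    have hc : 2 * K + 1 ≠ ⊤ := by finiteness
    have hpos : eLpNorm (d f) 2 volume / (2 * (2 * K + 1)) ≠ 0 :=
      (ENNReal.div_pos hne (by finiteness)).ne'
    have h := hsmall _ hpos
    have hfin : eLpNorm (d f) 2 volume ≠ ⊤ := by
      refine ((hbound hf).trans_lt ?_).ne
      have := hf.2.ne
      exact (ENNReal.mul_ne_top (by finiteness) this).lt_top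
    have : 2 * K * (eLpNorm (d f) 2 volume / (2 * (2 * K + 1))) ≤ eLpNorm (d f) 2 volume / 2 := by
      calc 2 * K * (eLpNorm (d f) 2 volume / (2 * (2 * K + 1)))
          ≤ (2 * K + 1) * (eLpNorm (d f) 2 volume / (2 * (2 * K + 1))) := by
            gcongr; exact le_self_add
        _ = eLpNorm (d f) 2 volume / 2 := by
            rw [mul_comm 2 (2 * K + 1), ← mul_div_assoc,
              ENNReal.mul_div_mul_left _ _ (by simp) hc]
    exact absurd (h.trans this) (not_le.2 (ENNReal.half_lt_self hne hfin))
  have h0 := (eLpNorm_eq_zero_iff (hmeas hf) (by norm_num)).1 hzero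
  filter_upwards [h0] with ξ hξ
  exact sub_eq_zero.1 hξ

end MultiplierL2

/-! ### The Fourier transform on `L^p` for `1 ≤ p ≤ 2` -/

section FourierLp

variable {n : ℕ} {f : EuclideanSpace ℝ (Fin n) → ℂ} {p : ℝ}

theorem enorm_indicator_rpow_le {S : Set (EuclideanSpace ℝ (Fin n))} {c r : ℝ} (hr : 0 < r)
    (hp : 0 ≤ p) (hc : 0 ≤ c) (h : ∀ x ∈ S, ‖f x‖ ^ r ≤ c * ‖f x‖ ^ p)
    (x : EuclideanSpace ℝ (Fin n)) :
    ‖S.indicator f x‖ₑ ^ r ≤ ENNReal.ofReal c * ‖f x‖ₑ ^ p := by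
  by_cases hx : x ∈ S
  · rw [Set.indicator_of_mem hx, ← ofReal_norm, ENNReal.ofReal_rpow_of_nonneg (norm_nonneg _) hr.le,
      ENNReal.ofReal_rpow_of_nonneg (norm_nonneg _) hp, ← ENNReal.ofReal_mul hc]
    exact ENNReal.ofReal_le_ofReal (h x hx)
  · simp [Set.indicator_of_notMem hx, ENNReal.zero_rpow_of_pos hr]

theorem lintegral_indicator_rpow_le {S : Set (EuclideanSpace ℝ (Fin n))} {c r : ℝ} (hr : 0 < r)
    (hp : 0 ≤ p) (hc : 0 ≤ c) (h : ∀ x ∈ S, ‖f x‖ ^ r ≤ c * ‖f x‖ ^ p) :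
    ∫⁻ x, ‖S.indicator f x‖ₑ ^ r ≤ ENNReal.ofReal c * ∫⁻ x, ‖f x‖ₑ ^ p := by
  rw [← lintegral_const_mul' _ _ ENNReal.ofReal_ne_top]
  exact lintegral_mono (enorm_indicator_rpow_le hr hp hc h)

theorem lintegral_rpow_lt_top (hp : 0 < p) (hf : MemLp f (ENNReal.ofReal p) volume) :
    ∫⁻ x, ‖f x‖ₑ ^ p < ⊤ := by
  have := lintegral_rpow_enorm_lt_top_of_eLpNorm_lt_top (by simpa using hp)
    ENNReal.ofReal_ne_top hf.2
  rwa [ENNReal.toReal_ofReal hp.le] at this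

theorem memLp_indicator_of_rpow_le {S : Set (EuclideanSpace ℝ (Fin n))}
    (hS : NullMeasurableSet S volume) {c r : ℝ} (hr : 0 < r) (hp : 0 < p) (hc : 0 ≤ c)
    (hf : MemLp f (ENNReal.ofReal p) volume) (h : ∀ x ∈ S, ‖f x‖ ^ r ≤ c * ‖f x‖ ^ p) :
    MemLp (S.indicator f) (ENNReal.ofReal r) volume := by
  refine ⟨hf.1.indicator₀ hS, ?_⟩
  rw [eLpNorm_lt_top_iff_lintegral_rpow_enorm_lt_top (by simpa using hr) ENNReal.ofReal_ne_top,
    ENNReal.toReal_ofReal hr.le]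
  exact (lintegral_indicator_rpow_le hr hp.le hc h).trans_lt
    (ENNReal.mul_lt_top ENNReal.ofReal_lt_top (lintegral_rpow_lt_top hp hf))

theorem integrable_indicator_one_lt (hp : 1 ≤ p) (hf : MemLp f (ENNReal.ofReal p) volume) :
    Integrable ({x | 1 < ‖f x‖}.indicator f) := by
  have h := memLp_indicator_of_rpow_le (S := {x | 1 < ‖f x‖}) (c := 1) (r := 1)
    (nullMeasurableSet_lt aemeasurable_const hf.1.norm.aemeasurable) one_pos (by linarith)
    zero_le_one hf fun x hx => by
      rw [one_mul]
      exact Real.rpow_le_rpow_of_exponent_le (le_of_lt hx) hp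
  rw [ENNReal.ofReal_one] at h
  exact memLp_one_iff_integrable.1 h

theorem memLp_indicator_le_one (hp : 0 < p) (hp2 : p ≤ 2)
    (hf : MemLp f (ENNReal.ofReal p) volume) :
    MemLp ({x | ‖f x‖ ≤ 1}.indicator f) 2 volume := by
  have h := memLp_indicator_of_rpow_le (S := {x | ‖f x‖ ≤ 1}) (c := 1) (r := 2)
    (nullMeasurableSet_le hf.1.norm.aemeasurable aemeasurable_const) two_pos hp
    zero_le_one hf fun x hx => by
      rw [one_mul]
      exact Real.rpow_le_rpow_of_exponent_ge' (norm_nonneg _) hx hp.le hp2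
  simpa using h

theorem indicator_one_lt_add_indicator_le_one (f : EuclideanSpace ℝ (Fin n) → ℂ) :
    {x | 1 < ‖f x‖}.indicator f + {x | ‖f x‖ ≤ 1}.indicator f = f := by
  have : {x | ‖f x‖ ≤ 1} = {x | 1 < ‖f x‖}ᶜ := by ext; simp
  rw [this]
  exact Set.indicator_self_add_compl _ _

/-- The transform on `L^p` may be computed from any splitting of `f` into an integrable and a
square-integrable part. -/
theorem fourierLp_ae_eq (hp : 1 ≤ p) (hp2 : p ≤ 2) (hf : MemLp f (ENNReal.ofReal p) volume)
    {g h : EuclideanSpace ℝ (Fin n) → ℂ} (hg : Integrable g) (hh : MemLp h 2 volume)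
    (hfgh : f =ᵐ[volume] g + h) : fourierLp f =ᵐ[volume] fourierL1 g + fourierL2 h := by
  have hl := integrable_indicator_one_lt hp hf
  have hs := memLp_indicator_le_one (by linarith) hp2 hf
  have hsum := indicator_one_lt_add_indicator_le_one f
  set l := {x | 1 < ‖f x‖}.indicator f with hl_def
  set s := {x | ‖f x‖ ≤ 1}.indicator f with hs_def
  have heq : l - g =ᵐ[volume] h - s := by
    filter_upwards [hfgh] with x hx
    have hx' : l x + s x = f x := congrFun hsum x
    simp only [Pi.sub_apply, Pi.add_apply] at *
    linear_combination hx' + hx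
  have hd2 : MemLp (l - g) 2 volume := (hh.sub hs).ae_eq heq.symm
  have e1 := fourierL2_ae_eq_fourierL1 (hl.sub hg) hd2
  rw [fourierL2_congr heq, fourierL1_sub hl hg] at e1
  filter_upwards [e1, fourierL2_sub hh hs] with ξ h1 h2
  simp only [fourierLp, ← hl_def, ← hs_def, Pi.add_apply, Pi.sub_apply] at *
  linear_combination h2 - h1

theorem aestronglyMeasurable_fourierLp (hp : 1 ≤ p) (hp2 : p ≤ 2)
    (hf : MemLp f (ENNReal.ofReal p) volume) : AEStronglyMeasurable (fourierLp f) volume :=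
  (continuous_fourierL1 (integrable_indicator_one_lt hp hf)).aestronglyMeasurable.add
    (memLp_fourierL2 (memLp_indicator_le_one (by linarith) hp2 hf)).1

theorem fourierLp_sphericalMean_sub (hn : 1 ≤ n) (hp : 1 ≤ p) (hp2 : p ≤ 2)
    (hf : MemLp f (ENNReal.ofReal p) volume) (t : ℝ) :
    fourierLp (fun x => sphericalMean t f x - f x) =ᵐ[volume]
      fun ξ => (sphereMultiplier (t • ξ) - 1) * fourierLp f ξ := by
  have hl := integrable_indicator_one_lt hp hf
  have hs := memLp_indicator_le_one (by linarith) hp2 hf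
  have hsum := indicator_one_lt_add_indicator_le_one f
  have hp1 : 1 ≤ ENNReal.ofReal p := by simpa using hp
  set l := {x | 1 < ‖f x‖}.indicator f with hl_def
  set s := {x | ‖f x‖ ≤ 1}.indicator f with hs_def
  have h12 : (1 : ℝ≥0∞) ≤ 2 := by norm_num
  have h2t : (2 : ℝ≥0∞) ≠ ⊤ := by norm_num
  have hl1 : MemLp l 1 volume := memLp_one_iff_integrable.2 hl
  have hMl : Integrable (sphericalMean t l) := memLp_one_iff_integrable.1
    (memLp_sphericalMean hn le_rfl ENNReal.one_ne_top hl1 t)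
  have hMs : MemLp (sphericalMean t s) 2 volume := memLp_sphericalMean hn h12 h2t hs t
  have hsplit : (fun x => sphericalMean t f x - f x) =ᵐ[volume]
      (sphericalMean t l - l) + (sphericalMean t s - s) := by
    have h := ae_sphericalMean_add hn le_rfl ENNReal.one_ne_top h12 h2t hl1 hs t
    rw [hsum] at h
    filter_upwards [h] with x hx
    have hx' : l x + s x = f x := congrFun hsum x
    simp only [Pi.add_apply, Pi.sub_apply] at *
    rw [hx, ← hx']
    ring
  have e1 := fourierLp_ae_eq hp hp2
    (memLp_sphericalMean_sub hn hp1 ENNReal.ofReal_ne_top hf t) (hMl.sub hl) (hMs.sub hs) hsplit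
  rw [fourierL1_sub hMl hl] at e1
  filter_upwards [e1, fourierL2_sub hMs hs, fourierL2_sphericalMean hn hs t] with ξ h1 h2 h3
  simp only [fourierLp, ← hl_def, ← hs_def, Pi.add_apply, Pi.sub_apply] at *
  rw [h1, h2, h3, fourierL1_sphericalMean hn hl]
  ring

end FourierLp

/-! ### The Hausdorff–Young inequality -/

section HausdorffYoung

variable {n : ℕ} {f : EuclideanSpace ℝ (Fin n) → ℂ} {p : ℝ}

theorem lintegral_enorm_fourierL2_sq (hf : MemLp f 2 volume) :
    ∫⁻ ξ, ‖fourierL2 f ξ‖ₑ ^ (2 : ℝ) = dilationConst n * ∫⁻ x, ‖f x‖ₑ ^ (2 : ℝ) := by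
  have h := congrArg (· ^ (2 : ℝ)) (eLpNorm_fourierL2 hf)
  simp only [eLpNorm_eq_lintegral_rpow_enorm_toReal (p := 2) (by norm_num) (by norm_num),
    ENNReal.toReal_ofNat] at h
  rw [ENNReal.mul_rpow_of_nonneg _ _ (by norm_num)] at h
  simp only [← ENNReal.rpow_mul] at h
  norm_num at h
  exact_mod_cast h

/-- The distribution function of `fourierLp f` at height `α`. The function is split at the value
of `‖f x‖` for which the transform of the large part is at most `α / 2` everywhere. -/
theorem measure_lt_fourierLp_le (hp : 1 < p) (hp2 : p < 2)
    (hf : MemLp f (ENNReal.ofReal p) volume) {N : ℝ} (hN : 0 < N)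
    (hfN : ∫⁻ x, ‖f x‖ₑ ^ p = ENNReal.ofReal N) {α : ℝ} (hα : 0 < α) :
    volume {ξ | α < ‖fourierLp f ξ‖} ≤ 4 * dilationConst n * ENNReal.ofReal (α ^ (-2 : ℝ)) *
      ∫⁻ x, {x | α * ‖f x‖ ^ (p - 1) ≤ 2 * N}.indicator (fun x => ‖f x‖ₑ ^ (2 : ℝ)) x := by
  set S := {x | α * ‖f x‖ ^ (p - 1) ≤ 2 * N}
  have hS : NullMeasurableSet S volume :=
    nullMeasurableSet_le ((hf.1.norm.aemeasurable.pow_const _).const_mul _) aemeasurable_const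
  have hSc : ∀ x ∈ Sᶜ, ‖f x‖ ^ (1 : ℝ) ≤ α / (2 * N) * ‖f x‖ ^ p := fun x hx => by
    have hx' : 2 * N < α * ‖f x‖ ^ (p - 1) := not_le.1 hx
    have hpow : ‖f x‖ ^ p = ‖f x‖ ^ (p - 1) * ‖f x‖ := by
      rw [← Real.rpow_add_one' (norm_nonneg _) (by linarith)]; ring_nf
    rw [Real.rpow_one, hpow, div_mul_eq_mul_div, le_div_iff₀ (by positivity)]
    nlinarith [norm_nonneg (f x)]
  have hSb : ∀ x ∈ S, ‖f x‖ ^ (2 : ℝ) ≤ (2 * N / α) ^ ((2 - p) / (p - 1)) * ‖f x‖ ^ p :=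
    fun x hx => by
      have hx' : ‖f x‖ ^ (p - 1) ≤ 2 * N / α := by
        rw [le_div_iff₀ hα, mul_comm]; exact hx
      have hp1 : 0 < p - 1 := by linarith
      have h1 : ‖f x‖ ^ (2 - p) ≤ (2 * N / α) ^ ((2 - p) / (p - 1)) := by
        have := Real.rpow_le_rpow (by positivity) hx'
          (div_nonneg (by linarith : 0 ≤ 2 - p) hp1.le)
        rwa [← Real.rpow_mul (norm_nonneg _), mul_div_cancel₀ _ hp1.ne'] at this
      calc ‖f x‖ ^ (2 : ℝ) = ‖f x‖ ^ (2 - p) * ‖f x‖ ^ p := by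
            rw [← Real.rpow_add_of_nonneg (norm_nonneg _) (by linarith) (by linarith)]
            ring_nf
        _ ≤ _ := by gcongr
  have hl := memLp_indicator_of_rpow_le hS.compl one_pos (by linarith) (by positivity) hf hSc
  rw [ENNReal.ofReal_one] at hl
  have hs : MemLp (S.indicator f) 2 volume := by
    simpa using memLp_indicator_of_rpow_le hS two_pos (by linarith) (by positivity) hf hSb
  have hae := fourierLp_ae_eq hp.le hp2.le hf (memLp_one_iff_integrable.1 hl) hs
    (Filter.EventuallyEq.of_eq (Set.indicator_compl_add_self S f).symm)
  have hlarge : ∀ ξ, ‖fourierL1 (Sᶜ.indicator f) ξ‖ ≤ α / 2 := fun ξ => by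
    have h1 := enorm_fourierL1_le (Sᶜ.indicator f) ξ
    have h2 := lintegral_indicator_rpow_le one_pos (by linarith) (by positivity) hSc
    simp only [ENNReal.rpow_one] at h2
    rw [hfN, ← ENNReal.ofReal_mul (by positivity), ← eLpNorm_one_eq_lintegral_enorm] at h2
    have h3 := h1.trans h2
    rw [← ofReal_norm, ENNReal.ofReal_le_ofReal_iff (by positivity)] at h3
    refine h3.trans_eq ?_
    field_simp
  have hsub : {ξ | α < ‖fourierLp f ξ‖} ≤ᵐ[volume]
      {ξ | ENNReal.ofReal (α / 2) ^ (2 : ℝ) ≤ ‖fourierL2 (S.indicator f) ξ‖ₑ ^ (2 : ℝ)} := by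
    filter_upwards [hae] with ξ hξ hlt
    have hlt' : α < ‖fourierLp f ξ‖ := hlt
    rw [hξ] at hlt'
    have := norm_add_le (fourierL1 (Sᶜ.indicator f) ξ) (fourierL2 (S.indicator f) ξ)
    have h2 := hlarge ξ
    have h3 : α / 2 ≤ ‖fourierL2 (S.indicator f) ξ‖ := by
      simp only [Pi.add_apply] at hlt'
      linarith
    refine ENNReal.rpow_le_rpow ?_ (by norm_num)
    rw [← ofReal_norm]
    exact ENNReal.ofReal_le_ofReal h3
  have hpos : ENNReal.ofReal (α / 2) ^ (2 : ℝ) ≠ 0 := by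
    rw [ENNReal.ofReal_rpow_of_pos (by positivity)]
    simpa using by positivity
  have hfin : ENNReal.ofReal (α / 2) ^ (2 : ℝ) ≠ ⊤ :=
    ENNReal.rpow_ne_top_of_nonneg (by norm_num) ENNReal.ofReal_ne_top
  have hcheb := meas_ge_le_lintegral_div ((memLp_fourierL2 hs).1.enorm.pow_const (2 : ℝ)) hpos hfin
  rw [lintegral_enorm_fourierL2_sq hs] at hcheb
  refine (measure_mono_ae hsub).trans (hcheb.trans_eq ?_)
  have hind : ∀ x, ‖S.indicator f x‖ₑ ^ (2 : ℝ) =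
      S.indicator (fun x => ‖f x‖ₑ ^ (2 : ℝ)) x := fun x => by
    by_cases hx : x ∈ S <;> simp [hx]
  simp only [hind]
  have hconst : (ENNReal.ofReal (α / 2) ^ (2 : ℝ))⁻¹ = 4 * ENNReal.ofReal (α ^ (-2 : ℝ)) := by
    rw [ENNReal.ofReal_rpow_of_pos (by positivity), ← ENNReal.ofReal_inv_of_pos (by positivity)]
    have h4 : (4 : ℝ≥0∞) = ENNReal.ofReal 4 := by simp
    rw [h4, ← ENNReal.ofReal_mul (by norm_num), Real.rpow_neg hα.le]
    congr 1
    norm_num [div_pow]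
    ring
  rw [div_eq_mul_inv, hconst]
  ring

theorem lintegral_Ioi_indicator_rpow {B r : ℝ} (hB : 0 ≤ B) (hr : 0 < r) :
    ∫⁻ α in Set.Ioi (0 : ℝ), {α | α ≤ B}.indicator (fun α => ENNReal.ofReal (α ^ (r - 1))) α =
      ENNReal.ofReal (B ^ r / r) := by
  rw [lintegral_indicator (by exact measurableSet_Iic), Measure.restrict_restrict
    (by exact measurableSet_Iic)]
  have hset : {α | α ≤ B} ∩ Set.Ioi (0 : ℝ) = Set.Ioc 0 B := by ext; simp [and_comm]
  rw [hset, ← ofReal_integral_eq_lintegral_ofReal, ← intervalIntegral.integral_of_le hB,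
    integral_rpow (Or.inl (by linarith))]
  · rw [sub_add_cancel, Real.zero_rpow hr.ne', sub_zero]
  · exact (intervalIntegrable_iff_integrableOn_Ioc_of_le hB).1
      (intervalIntegral.intervalIntegrable_rpow' (by linarith))
  · refine (ae_restrict_mem measurableSet_Ioc).mono fun α hα => ?_
    exact Real.rpow_nonneg hα.1.le _

/-- The real interpolation between `L¹ → L^∞` and `L² → L²`: the distribution function bound is
integrated over all heights, with the order of integration exchanged. -/
theorem lintegral_fourierLp_rpow_le {q : ℝ} (hp : 1 < p) (hp2 : p < 2) (hpq : p.HolderConjugate q)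
    (hf : MemLp f (ENNReal.ofReal p) volume) {N : ℝ} (hN : 0 < N)
    (hfN : ∫⁻ x, ‖f x‖ₑ ^ p = ENNReal.ofReal N) :
    ∫⁻ ξ, ‖fourierLp f ξ‖ₑ ^ q ≤
      ENNReal.ofReal q * (4 * dilationConst n * ENNReal.ofReal (2 ^ (q - 2) / (q - 2))) *
        ENNReal.ofReal N ^ (q - 1) := by
  have hmul : (p - 1) * q = p := hpq.sub_one_mul_conj
  have hq2 : 2 < q := by nlinarith [hpq.symm.pos]
  have hFm := aestronglyMeasurable_fourierLp hp.le hp2.le hf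
  have hK : 4 * dilationConst n ≠ ⊤ :=
    ENNReal.mul_ne_top (by norm_num) (dilationConst_ne_top n)
  -- the joint integrand after the distribution function bound is inserted
  let G : ℝ → EuclideanSpace ℝ (Fin n) → ℝ≥0∞ := fun α x =>
    {z : ℝ × EuclideanSpace ℝ (Fin n) | z.1 * ‖f z.2‖ ^ (p - 1) ≤ 2 * N}.indicator
      (fun z => ENNReal.ofReal (z.1 ^ (q - 2 - 1)) * ‖f z.2‖ₑ ^ (2 : ℝ)) (α, x)
  have hGm : AEMeasurable (Function.uncurry G)
      ((volume.restrict (Set.Ioi (0 : ℝ))).prod volume) := by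
    have hn : AEMeasurable (fun z : ℝ × EuclideanSpace ℝ (Fin n) => ‖f z.2‖)
      ((volume.restrict (Set.Ioi (0 : ℝ))).prod volume) := hf.1.norm.aemeasurable.comp_snd
    have he : AEMeasurable (fun z : ℝ × EuclideanSpace ℝ (Fin n) => ‖f z.2‖ₑ)
      ((volume.restrict (Set.Ioi (0 : ℝ))).prod volume) := hf.1.enorm.comp_snd
    refine AEMeasurable.indicator₀ ?_ ?_
    · exact (measurable_fst.pow_const _).ennreal_ofReal.aemeasurable.mul (he.pow_const _)
    · exact nullMeasurableSet_le (measurable_fst.aemeasurable.mul (hn.pow_const _))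
        aemeasurable_const
  have hinner : ∀ x, ∫⁻ α in Set.Ioi (0 : ℝ), G α x =
      ENNReal.ofReal ((2 * N) ^ (q - 2) / (q - 2)) * ‖f x‖ₑ ^ p := by
    intro x
    rcases eq_or_ne (f x) 0 with h0 | h0
    · have : ∀ α, G α x = 0 := fun α => by
        simp only [G, Set.indicator_apply_eq_zero, h0]
        simp
      simp [this, h0, ENNReal.zero_rpow_of_pos (by linarith : 0 < p)]
    · have hy : 0 < ‖f x‖ := norm_pos_iff.2 h0
      have hyp : 0 < ‖f x‖ ^ (p - 1) := Real.rpow_pos_of_pos hy _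
      set B := 2 * N / ‖f x‖ ^ (p - 1) with hB
      have hG : ∀ α, G α x = {α | α ≤ B}.indicator
          (fun α => ENNReal.ofReal (α ^ (q - 2 - 1))) α * ‖f x‖ₑ ^ (2 : ℝ) := fun α => by
        have hiff : α * ‖f x‖ ^ (p - 1) ≤ 2 * N ↔ α ≤ B := (le_div_iff₀ hyp).symm
        by_cases hα : α ≤ B
        · simp only [G, Set.indicator, Set.mem_ofPred_eq, hiff, hα, if_true]
        · simp only [G, Set.indicator, Set.mem_ofPred_eq, hiff, hα, if_false, zero_mul]
      simp only [hG]
      rw [lintegral_mul_const' _ _ (ENNReal.rpow_ne_top_of_nonneg (by norm_num) enorm_ne_top),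
        lintegral_Ioi_indicator_rpow (by positivity) (by linarith), ← ofReal_norm,
        ENNReal.ofReal_rpow_of_pos hy, ENNReal.ofReal_rpow_of_pos hy,
        ← ENNReal.ofReal_mul (div_nonneg (by positivity) (by linarith)),
        ← ENNReal.ofReal_mul (div_nonneg (by positivity) (by linarith))]
      congr 1
      have hexp : ‖f x‖ ^ (2 : ℝ) = (‖f x‖ ^ (p - 1)) ^ (q - 2) * ‖f x‖ ^ p := by
        rw [← Real.rpow_mul hy.le, ← Real.rpow_add hy]
        congr 1
        linear_combination -hmul
      rw [hB, Real.div_rpow (by positivity) hyp.le, hexp]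
      have : (‖f x‖ ^ (p - 1)) ^ (q - 2) ≠ 0 := by positivity
      have : q - 2 ≠ 0 := by linarith
      field_simp
  have hlayer := lintegral_rpow_eq_lintegral_meas_lt_mul volume
    (f := fun ξ => ‖fourierLp f ξ‖) (Filter.Eventually.of_forall fun ξ => norm_nonneg _)
    hFm.norm.aemeasurable (p := q) (by linarith)
  have hlhs : ∫⁻ ξ, ‖fourierLp f ξ‖ₑ ^ q = ∫⁻ ξ, ENNReal.ofReal (‖fourierLp f ξ‖ ^ q) :=
    lintegral_congr fun ξ => by
      rw [← ofReal_norm, ENNReal.ofReal_rpow_of_nonneg (norm_nonneg _) (by linarith)]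
  rw [hlhs, hlayer, mul_assoc]
  gcongr
  calc ∫⁻ α in Set.Ioi (0 : ℝ),
        volume {ξ | α < ‖fourierLp f ξ‖} * ENNReal.ofReal (α ^ (q - 1))
      ≤ ∫⁻ α in Set.Ioi (0 : ℝ), 4 * dilationConst n * ∫⁻ x, G α x := by
        refine setLIntegral_mono' measurableSet_Ioi fun α hα => ?_
        have hα : 0 < α := hα
        refine (mul_le_mul_left (measure_lt_fourierLp_le hp hp2 hf hN hfN hα) _).trans_eq ?_
        have hG : ∫⁻ x, G α x = ENNReal.ofReal (α ^ (q - 2 - 1)) *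
            ∫⁻ x, {x | α * ‖f x‖ ^ (p - 1) ≤ 2 * N}.indicator (fun x => ‖f x‖ₑ ^ (2 : ℝ)) x := by
          rw [← lintegral_const_mul' _ _ ENNReal.ofReal_ne_top]
          refine lintegral_congr fun x => ?_
          by_cases hx : α * ‖f x‖ ^ (p - 1) ≤ 2 * N
          · simp only [G, Set.indicator, Set.mem_ofPred_eq, hx, if_true]
          · simp only [G, Set.indicator, Set.mem_ofPred_eq, hx, if_false, mul_zero]
        have hpow : α ^ (q - 2 - 1) = α ^ (-2 : ℝ) * α ^ (q - 1) := by
          rw [← Real.rpow_add hα]; ring_nf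
        rw [hG, hpow, ENNReal.ofReal_mul (by positivity)]
        ring
    _ = 4 * dilationConst n * ∫⁻ x, ∫⁻ α in Set.Ioi (0 : ℝ), G α x := by
        rw [lintegral_const_mul' _ _ hK, lintegral_lintegral_swap hGm]
    _ = 4 * dilationConst n *
          (ENNReal.ofReal ((2 * N) ^ (q - 2) / (q - 2)) * ENNReal.ofReal N) := by
        simp only [hinner]
        rw [lintegral_const_mul' _ _ ENNReal.ofReal_ne_top, hfN]
    _ = _ := by
        rw [mul_assoc (4 * dilationConst n), ENNReal.ofReal_rpow_of_pos hN,
          ← ENNReal.ofReal_mul (div_nonneg (by positivity) (by linarith)),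
          ← ENNReal.ofReal_mul (div_nonneg (by positivity) (by linarith))]
        congr 2
        have : N ^ (q - 1) = N ^ (q - 2) * N := by
          rw [← Real.rpow_add_one hN.ne']; ring_nf
        rw [this, Real.mul_rpow (by norm_num) hN.le]
        ring

/-- The Hausdorff–Young inequality, with a constant that is not sharp. -/
theorem exists_hausdorffYoung (n : ℕ) {p q : ℝ} (hp : 1 < p) (hp2 : p < 2)
    (hpq : p.HolderConjugate q) :
    ∃ C : ℝ≥0, ∀ f : EuclideanSpace ℝ (Fin n) → ℂ, MemLp f (ENNReal.ofReal p) volume →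
      (∫⁻ ξ, ‖fourierLp f ξ‖ₑ ^ q) ^ (1 / q) ≤ C * eLpNorm f (ENNReal.ofReal p) volume := by
  have hq0 : 0 < q := hpq.symm.pos
  set A := ENNReal.ofReal q *
    (4 * dilationConst n * ENNReal.ofReal (2 ^ (q - 2) / (q - 2))) with hA
  have hAt : A ≠ ⊤ := by
    have := dilationConst_ne_top n
    finiteness
  refine ⟨(A ^ (1 / q)).toNNReal, fun f hf => ?_⟩
  rw [ENNReal.coe_toNNReal (ENNReal.rpow_ne_top_of_nonneg (by positivity) hAt),
    eLpNorm_eq_lintegral_rpow_enorm_toReal (by simpa using by linarith) ENNReal.ofReal_ne_top,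
    ENNReal.toReal_ofReal (by linarith)]
  have hfin := lintegral_rpow_lt_top (by linarith) hf
  rcases eq_or_ne (∫⁻ x, ‖f x‖ₑ ^ p) 0 with h0 | h0
  · have hf0 : f =ᵐ[volume] 0 + 0 := by
      rw [lintegral_eq_zero_iff' (hf.1.enorm.pow_const p)] at h0
      filter_upwards [h0] with x hx
      simpa [ENNReal.rpow_eq_zero_iff, (by linarith : 0 < p)] using hx
    have hF := fourierLp_ae_eq hp.le hp2.le hf (integrable_zero _ _ _) MemLp.zero hf0
    have h2' : fourierL2 (0 : EuclideanSpace ℝ (Fin n) → ℂ) =ᵐ[volume] 0 := by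
      have hm := eLpNorm_fourierL2
        (MemLp.zero (ε := ℂ) (p := 2) (μ := (volume : Measure (EuclideanSpace ℝ (Fin n)))))
      rw [eLpNorm_zero, mul_zero, eLpNorm_eq_zero_iff (memLp_fourierL2 MemLp.zero).1
        (by norm_num)] at hm
      exact hm
    have hz : ∫⁻ ξ, ‖fourierLp f ξ‖ₑ ^ q = 0 := by
      rw [lintegral_eq_zero_iff'
        ((aestronglyMeasurable_fourierLp hp.le hp2.le hf).enorm.pow_const q)]
      filter_upwards [hF, h2'] with ξ h h'
      simp [h, h', fourierL1, ENNReal.zero_rpow_of_pos hq0]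
    rw [hz, ENNReal.zero_rpow_of_pos (by positivity)]
    exact zero_le
  · have hN := ENNReal.toReal_pos h0 hfin.ne
    have h := lintegral_fourierLp_rpow_le hp hp2 hpq hf hN (ENNReal.ofReal_toReal hfin.ne).symm
    rw [ENNReal.ofReal_toReal hfin.ne, ← hA] at h
    refine (ENNReal.rpow_le_rpow h (by positivity)).trans_eq ?_
    rw [ENNReal.mul_rpow_of_nonneg _ _ (by positivity), ← ENNReal.rpow_mul]
    congr 2
    have := hpq.symm.sub_one_mul_conj
    have hp0 : p ≠ 0 := by linarith
    field_simp
    linarith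

end HausdorffYoung

/-! ### Growth estimates -/

section Growth

variable {n : ℕ} {t : ℝ}

theorem enorm_le_enorm_sphereMultiplier_sub_one_mul (hn : 2 ≤ n) (ht : 0 < t)
    (ξ : EuclideanSpace ℝ (Fin n)) (z : ℂ) :
    ENNReal.ofReal (min 1 ((t * ‖ξ‖) ^ 2)) * ‖z‖ₑ ≤
      ENNReal.ofReal (100 * Real.pi * n) * ‖((sphereMultiplier (t • ξ) : ℂ) - 1) * z‖ₑ := by
  have hlow := le_one_sub_sphereMultiplier hn (t • ξ)
  rw [norm_smul, Real.norm_of_nonneg ht.le, one_div_mul_eq_div, div_le_iff₀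
    (by have := Real.pi_pos; positivity)] at hlow
  rw [enorm_mul, ← mul_assoc]
  gcongr
  rw [← ofReal_norm, ← ENNReal.ofReal_mul (by have := Real.pi_pos; positivity), norm_sub_rev,
    ← Complex.ofReal_one, ← Complex.ofReal_sub, Complex.norm_real]
  refine ENNReal.ofReal_le_ofReal (hlow.trans ?_)
  rw [mul_comm]
  gcongr
  exact le_abs_self _

theorem enorm_sphereMultiplier_sub_one_mul_le (hn : 1 ≤ n) (ht : 0 < t)
    (ξ : EuclideanSpace ℝ (Fin n)) (z : ℂ) :
    ‖((sphereMultiplier (t • ξ) : ℂ) - 1) * z‖ₑ ≤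
      2 * (ENNReal.ofReal (min 1 ((t * ‖ξ‖) ^ 2)) * ‖z‖ₑ) := by
  have hup := one_sub_sphereMultiplier_le hn (t • ξ)
  rw [norm_smul, Real.norm_of_nonneg ht.le] at hup
  have h2 : 2 * ENNReal.ofReal (min 1 ((t * ‖ξ‖) ^ 2)) =
      ENNReal.ofReal (2 * min 1 ((t * ‖ξ‖) ^ 2)) := by
    rw [ENNReal.ofReal_mul (by norm_num), ENNReal.ofReal_ofNat]
  rw [enorm_mul, ← mul_assoc]
  gcongr
  rw [h2, ← ofReal_norm, norm_sub_rev,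
    ← Complex.ofReal_one, ← Complex.ofReal_sub, Complex.norm_real, Real.norm_eq_abs,
    abs_of_nonneg (by linarith [(abs_le.1 (abs_sphereMultiplier_le_one hn (t • ξ))).2])]
  exact ENNReal.ofReal_le_ofReal hup

theorem ofReal_min_one_rpow {s q : ℝ} (hs : 0 ≤ s) (hq : 0 ≤ q) :
    ENNReal.ofReal (min 1 (s ^ (2 * q))) = ENNReal.ofReal (min 1 (s ^ 2)) ^ q := by
  have hs2 : 0 ≤ s ^ 2 := sq_nonneg s
  rw [ENNReal.ofReal_rpow_of_nonneg (le_min zero_le_one hs2) hq, Real.rpow_mul hs]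
  congr 1
  norm_cast
  rcases le_total 1 (s ^ 2) with h | h
  · rw [min_eq_left h, min_eq_left (Real.one_le_rpow h hq), Real.one_rpow]
  · rw [min_eq_right h, min_eq_right (Real.rpow_le_one hs2 h hq)]

theorem exists_fourierLp_growth_le (hn : 2 ≤ n) {p q : ℝ} (hp : 1 < p) (hp2 : p < 2)
    (hpq : p.HolderConjugate q) :
    ∃ C : ℝ≥0, ∀ (t : ℝ) (f : EuclideanSpace ℝ (Fin n) → ℂ), 0 < t →
      MemLp f (ENNReal.ofReal p) volume →
        (∫⁻ ξ : EuclideanSpace ℝ (Fin n),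
            ENNReal.ofReal (min 1 ((t * ‖ξ‖) ^ (2 * q))) * ‖fourierLp f ξ‖ₑ ^ q) ^ (1 / q)
          ≤ C * eLpNorm (fun x => sphericalMean t f x - f x) (ENNReal.ofReal p) volume := by
  obtain ⟨C, hC⟩ := exists_hausdorffYoung n hp hp2 hpq
  have hq0 : 0 < q := hpq.symm.pos
  have hn1 : 1 ≤ n := by lia
  refine ⟨(100 * Real.pi * n).toNNReal * C, fun t f ht hf => ?_⟩
  have hg := memLp_sphericalMean_sub hn1 (by simpa using hp.le) ENNReal.ofReal_ne_top hf t
  set A := ENNReal.ofReal (100 * Real.pi * n) with hA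
  have hpt : ∀ᵐ ξ : EuclideanSpace ℝ (Fin n),
      ENNReal.ofReal (min 1 ((t * ‖ξ‖) ^ (2 * q))) * ‖fourierLp f ξ‖ₑ ^ q ≤
        A ^ q * ‖fourierLp (fun x => sphericalMean t f x - f x) ξ‖ₑ ^ q := by
    filter_upwards [fourierLp_sphericalMean_sub hn1 hp.le hp2.le hf t] with ξ hξ
    rw [hξ, ofReal_min_one_rpow (by positivity) hq0.le, ← ENNReal.mul_rpow_of_nonneg _ _ hq0.le,
      ← ENNReal.mul_rpow_of_nonneg _ _ hq0.le]
    exact ENNReal.rpow_le_rpow (enorm_le_enorm_sphereMultiplier_sub_one_mul hn ht ξ _) hq0.le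
  calc _ ≤ (A ^ q * ∫⁻ ξ, ‖fourierLp (fun x => sphericalMean t f x - f x) ξ‖ₑ ^ q) ^ (1 / q) := by
        refine ENNReal.rpow_le_rpow ?_ (by positivity)
        rw [← lintegral_const_mul' _ _
          (ENNReal.rpow_ne_top_of_nonneg hq0.le ENNReal.ofReal_ne_top)]
        exact lintegral_mono_ae hpt
    _ = A * (∫⁻ ξ, ‖fourierLp (fun x => sphericalMean t f x - f x) ξ‖ₑ ^ q) ^ (1 / q) := by
        rw [ENNReal.mul_rpow_of_nonneg _ _ (by positivity), ← ENNReal.rpow_mul,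
          mul_one_div_cancel hq0.ne', ENNReal.rpow_one]
    _ ≤ A * (C * eLpNorm (fun x => sphericalMean t f x - f x) (ENNReal.ofReal p) volume) := by
        gcongr
        exact hC _ hg
    _ = _ := by rw [ENNReal.coe_mul, mul_assoc]; rfl

theorem fourierL1_growth_le (hn : 2 ≤ n) (ht : 0 < t) {f : EuclideanSpace ℝ (Fin n) → ℂ}
    (hf : MemLp f 1 volume) (ξ : EuclideanSpace ℝ (Fin n)) :
    ENNReal.ofReal (min 1 ((t * ‖ξ‖) ^ 2)) * ‖fourierL1 f ξ‖ₑ ≤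
      ENNReal.ofReal (100 * Real.pi * n) *
        eLpNorm (fun x => sphericalMean t f x - f x) 1 volume := by
  have hn1 : 1 ≤ n := by lia
  have hf1 := memLp_one_iff_integrable.1 hf
  have hM := memLp_one_iff_integrable.1 (memLp_sphericalMean hn1 le_rfl ENNReal.one_ne_top hf t)
  refine (enorm_le_enorm_sphereMultiplier_sub_one_mul hn ht ξ _).trans ?_
  gcongr
  refine le_trans (le_of_eq ?_) (enorm_fourierL1_le _ ξ)
  have h := congrFun (fourierL1_sub hM hf1) ξ
  simp only [Pi.sub_apply, fourierL1_sphericalMean hn1 hf1] at h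
  change _ = ‖fourierL1 (sphericalMean t f - f) ξ‖ₑ
  rw [h, sub_mul, one_mul]

theorem fourierL2_sphericalMean_sub (hn : 1 ≤ n) {f : EuclideanSpace ℝ (Fin n) → ℂ}
    (hf : MemLp f 2 volume) (t : ℝ) :
    fourierL2 (fun x => sphericalMean t f x - f x) =ᵐ[volume]
      fun ξ => ((sphereMultiplier (t • ξ) : ℂ) - 1) * fourierL2 f ξ := by
  have hM := memLp_sphericalMean hn (by norm_num) (by norm_num) hf t
  filter_upwards [fourierL2_sub hM hf, fourierL2_sphericalMean hn hf t] with ξ h1 h2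
  change fourierL2 (sphericalMean t f - f) ξ = _
  rw [h1, Pi.sub_apply, h2]
  ring

/-- By Plancherel's theorem the `L²` norm of `M^t f - f` is that of its transform. -/
theorem rpow_lintegral_fourierL2_sphericalMean_sub (hn : 1 ≤ n)
    {f : EuclideanSpace ℝ (Fin n) → ℂ} (hf : MemLp f 2 volume) (t : ℝ) :
    (∫⁻ ξ, ‖((sphereMultiplier (t • ξ) : ℂ) - 1) * fourierL2 f ξ‖ₑ ^ 2) ^ (1 / 2 : ℝ) =
      dilationConst n ^ (1 / 2 : ℝ) *
        eLpNorm (fun x => sphericalMean t f x - f x) 2 volume := by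
  have hg := memLp_sphericalMean_sub hn (by norm_num) (by norm_num) hf t
  rw [← eLpNorm_fourierL2 hg, eLpNorm_congr_ae (fourierL2_sphericalMean_sub hn hf t),
    eLpNorm_eq_lintegral_rpow_enorm_toReal (by norm_num) (by norm_num)]
  simp

theorem rpow_lintegral_sq_le {μ : Measure (EuclideanSpace ℝ (Fin n))}
    {u v : EuclideanSpace ℝ (Fin n) → ℝ≥0∞} {A : ℝ≥0∞} (hA : A ≠ ⊤) (h : ∀ ξ, u ξ ≤ A * v ξ) :
    (∫⁻ ξ, u ξ ^ 2 ∂μ) ^ (1 / 2 : ℝ) ≤ A * (∫⁻ ξ, v ξ ^ 2 ∂μ) ^ (1 / 2 : ℝ) := by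
  calc (∫⁻ ξ, u ξ ^ 2 ∂μ) ^ (1 / 2 : ℝ) ≤ (A ^ 2 * ∫⁻ ξ, v ξ ^ 2 ∂μ) ^ (1 / 2 : ℝ) := by
        refine ENNReal.rpow_le_rpow ?_ (by norm_num)
        rw [← lintegral_const_mul' _ _ (by finiteness)]
        refine lintegral_mono fun ξ => ?_
        rw [← mul_pow]
        gcongr
        exact h ξ
    _ = _ := by
        rw [ENNReal.mul_rpow_of_nonneg _ _ (by norm_num), ← ENNReal.rpow_natCast_mul]
        norm_num

theorem ofReal_min_one_pow_four_mul_sq (s : ℝ) (z : ℝ≥0∞) :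
    ENNReal.ofReal (min 1 (s ^ 4)) * z ^ 2 = (ENNReal.ofReal (min 1 (s ^ 2)) * z) ^ 2 := by
  have hs2 : 0 ≤ s ^ 2 := sq_nonneg s
  rw [mul_pow, ← ENNReal.ofReal_pow (le_min zero_le_one hs2)]
  congr 2
  have h4 : s ^ 4 = (s ^ 2) ^ 2 := by ring
  rw [h4]
  rcases le_total 1 (s ^ 2) with h | h
  · rw [min_eq_left h, min_eq_left (one_le_pow₀ h), one_pow]
  · rw [min_eq_right h, min_eq_right (pow_le_one₀ hs2 h)]

theorem le_fourierL2_growth (hn : 1 ≤ n) (ht : 0 < t) {f : EuclideanSpace ℝ (Fin n) → ℂ}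
    (hf : MemLp f 2 volume) :
    dilationConst n ^ (1 / 2 : ℝ) * eLpNorm (fun x => sphericalMean t f x - f x) 2 volume ≤
      2 * (∫⁻ ξ : EuclideanSpace ℝ (Fin n),
        ENNReal.ofReal (min 1 ((t * ‖ξ‖) ^ 4)) * ‖fourierL2 f ξ‖ₑ ^ 2) ^ (1 / 2 : ℝ) := by
  rw [← rpow_lintegral_fourierL2_sphericalMean_sub hn hf]
  simp only [ofReal_min_one_pow_four_mul_sq]
  exact rpow_lintegral_sq_le (by norm_num) fun ξ =>
    enorm_sphereMultiplier_sub_one_mul_le hn ht ξ _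

theorem fourierL2_growth_le (hn : 2 ≤ n) (ht : 0 < t) {f : EuclideanSpace ℝ (Fin n) → ℂ}
    (hf : MemLp f 2 volume) :
    (∫⁻ ξ : EuclideanSpace ℝ (Fin n),
        ENNReal.ofReal (min 1 ((t * ‖ξ‖) ^ 4)) * ‖fourierL2 f ξ‖ₑ ^ 2) ^ (1 / 2 : ℝ) ≤
      ENNReal.ofReal (100 * Real.pi * n) * (dilationConst n ^ (1 / 2 : ℝ) *
        eLpNorm (fun x => sphericalMean t f x - f x) 2 volume) := by
  rw [← rpow_lintegral_fourierL2_sphericalMean_sub (by lia) hf]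
  simp only [ofReal_min_one_pow_four_mul_sq]
  exact rpow_lintegral_sq_le ENNReal.ofReal_ne_top fun ξ =>
    enorm_le_enorm_sphereMultiplier_sub_one_mul hn ht ξ _

end Growth

end SphericalGrowth

open SphericalGrowth in
theorem theorem2 (n : ℕ) (hn : 2 ≤ n) :
    (∀ p q : ℝ, 1 < p → p < 2 → p.HolderConjugate q →
      ∃ C : ℝ≥0, ∀ (t : ℝ) (f : EuclideanSpace ℝ (Fin n) → ℂ), 0 < t →
        MemLp f (ENNReal.ofReal p) volume →
          (∫⁻ ξ : EuclideanSpace ℝ (Fin n),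
              ENNReal.ofReal (min 1 ((t * ‖ξ‖) ^ (2 * q))) * ‖fourierLp f ξ‖ₑ ^ q) ^ (1 / q)
            ≤ C * eLpNorm (fun x => sphericalMean t f x - f x) (ENNReal.ofReal p) volume) ∧
    (∃ C : ℝ≥0, ∀ (t : ℝ) (f : EuclideanSpace ℝ (Fin n) → ℂ), 0 < t →
        MemLp f 1 volume →
          (⨆ ξ : EuclideanSpace ℝ (Fin n),
              ENNReal.ofReal (min 1 ((t * ‖ξ‖) ^ 2)) * ‖fourierL1 f ξ‖ₑ)
            ≤ C * eLpNorm (fun x => sphericalMean t f x - f x) 1 volume) ∧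
    (∃ c C : ℝ≥0, 0 < c ∧ 0 < C ∧ ∀ (t : ℝ) (f : EuclideanSpace ℝ (Fin n) → ℂ), 0 < t →
        MemLp f 2 volume →
          c * eLpNorm (fun x => sphericalMean t f x - f x) 2 volume
            ≤ (∫⁻ ξ : EuclideanSpace ℝ (Fin n),
                ENNReal.ofReal (min 1 ((t * ‖ξ‖) ^ 4)) * ‖fourierL2 f ξ‖ₑ ^ 2) ^ (1 / 2 : ℝ) ∧
          (∫⁻ ξ : EuclideanSpace ℝ (Fin n),
                ENNReal.ofReal (min 1 ((t * ‖ξ‖) ^ 4)) * ‖fourierL2 f ξ‖ₑ ^ 2) ^ (1 / 2 : ℝ)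
            ≤ C * eLpNorm (fun x => sphericalMean t f x - f x) 2 volume) := by
  have hpi := Real.pi_pos
  have hn0 : (0 : ℝ) < n := by positivity
  refine ⟨fun p q hp hp2 hpq => exists_fourierLp_growth_le hn hp hp2 hpq,
    ⟨(100 * Real.pi * n).toNNReal, fun t f ht hf => iSup_le (fourierL1_growth_le hn ht hf)⟩, ?_⟩
  set K := (dilationConst n ^ (1 / 2 : ℝ)).toNNReal
  have hKt : dilationConst n ^ (1 / 2 : ℝ) ≠ ⊤ :=
    ENNReal.rpow_ne_top_of_nonneg (by norm_num) (dilationConst_ne_top n)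
  have hKc : (K : ℝ≥0∞) = dilationConst n ^ (1 / 2 : ℝ) := ENNReal.coe_toNNReal hKt
  have hK0 : 0 < K := by
    rw [← ENNReal.coe_pos, hKc]
    exact ENNReal.rpow_pos (pos_iff_ne_zero.2 (dilationConst_ne_zero n)) (dilationConst_ne_top n)
  refine ⟨K / 2, (100 * Real.pi * n).toNNReal * K, by positivity,
    mul_pos (Real.toNNReal_pos.2 (by positivity)) hK0, fun t f ht hf => ⟨?_, ?_⟩⟩
  · have h := le_fourierL2_growth (by lia) ht hf
    rw [← hKc] at h
    rw [ENNReal.coe_div two_ne_zero, div_eq_mul_inv, mul_right_comm, ← div_eq_mul_inv]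
    exact ENNReal.div_le_of_le_mul' h
  · have h := fourierL2_growth_le hn ht hf
    rw [← hKc, ← mul_assoc] at h
    exact h
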